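/- Let $\mathbb N=\{1,2,3,\dots\}$. For $i<j$ let $(ij)$ and $(ij)_-$ be the linear maps of $\mathbb R^{\mathbb N}$ that replace the coordinates $(x_i,x_j)$ by $(x_j,x_i)$ and by $(-x_j,-x_i)$, respectively; these are reflections in the hyperplanes $x_i=x_j$ and $x_i=-x_j$. Let $\mathcal D$ be the group generated by all of them and $\mathcal D_+$ the subgroup generated by the $(ij)$. Put $v_-=(-1,-2,-3,\dots)$. Let $C'$ be the set of points that lie strictly on the same side as $v_-$ of each of these hyperplanes, and let $C_0\supset C'$ be the chamber of $\mathcal D_+$ consisting of the strictly descending sequences. An alcove is a set $wC'$ with $w\in\mathcal D$; it is dominant if it lies in $C_0$; its length $l(A)$ is the number of hyperplanes that separate $A$ from $C'$. Let $G$ be the directed graph whose vertices are the dominant alcoves, with an edge $(A,B)$ if $B=tA$ for a reflection $t$ whose hyperplane makes a wall of $A$ (that is, $\overline A$ contains a point of it that is on no other hyperplane) and $l(B)=l(A)+1$; write $D<A$ if there is a directed path of positive length from $D$ to $A$. The group $\mathcal D$ acts on pairs of alcoves, and the orbit of an edge is meant in this sense. The parabolic Kazhdan–Lusztig polynomials $p_{A,D}=p_A(D)\in\mathbb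 Z[v]$ of $\mathcal D/\mathcal D_+$, for dominant alcoves $A,D$, are given by the following recursion. For the root, $p_{C'}(C')=1$ and $p_{C'}(D)=0$ if $D\ne C'$. For $A\neq C'$ pick an edge $(B,A)$ of $G$, and put $$p'_A(D)=\sum_{D'}\bigl(v^{-1}p_B(D)+p_B(D')\bigr)+\sum_{D''}\bigl(v\,p_B(D)+p_B(D'')\bigr),$$ where $D'$ runs over the dominant alcoves such that $(D',D)$ is an edge of $G$ in the orbit of $(B,A)$, and $D''$ over those such that $(D,D'')$ is an edge of $G$ in this orbit. Then $$p_A=p'_A-\sum_{D<A}p'_A(D)|_{v=0}\;p_D .$$ Label a dominant alcove $A$ by the set of positive entries of the point of the orbit $\mathcal D v_-$ that lies in $A$. For a finite set $a\subset\mathbb N$, regarded as the binary sequence with a $1$ in position $i$ if and only if $i\in a$, the set of arcs $\Gamma^a$ is obtained as follows: join every $0$ to a $1$ that follows it immediately; ignore the positions joined so far and repeat, until no $0$ is followed immediately by a $1$ in the remaining sequence; finally join the remaining $1$s in adjacent pairs from the left (leaving out the last one if their number is odd). The hypercube $h^a$ has one vertex for each subset $S\subseteq\Gamma^a$, namely the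 set obtained from $a$ by replacing $01\to10$ or $11\to00$ at the ends of each arc in $S$; this vertex is at depth $|S|$. Theorem. The labelling is a bijection from the dominant alcoves to the finite subsets of $\mathbb N$ of even order. The polynomials $p_{A,B}$ do not depend on the edges picked in the recursion. If $A$ and $B$ have the labels $a$ and $b$, then $p_{A,B}=v^i$ if $b$ is a vertex of $h^a$ at depth $i$, and $p_{A,B}=0$ if $b$ is not a vertex of $h^a$. -/

import Mathlib

/-!
Positive integers `ℕ+ = {1, 2, 3, …}` index the coordinates of `ℝ^ℕ`.
-/

namespace DKL

open scoped LaurentPolynomial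

noncomputable section

/-- The space `ℝ^ℕ`. -/
abbrev Space : Type := ℕ+ → ℝ

/-! ### The reflection group `𝒟` and its hyperplanes -/

/-- Index of a reflection of `𝒟`: a pair `i < j` together with a sign. The value `neg = false`
stands for `(i j)`, the value `neg = true` for `(i j)₋`. -/
structure Refl where
  i : ℕ+
  j : ℕ+
  lt : i < j
  neg : Bool

/-- A linear form whose kernel is the reflection hyperplane:
`x_i - x_j` for `(i j)` and `x_i + x_j` for `(i j)₋`. -/
def Refl.form (r : Refl) (x : Space) : ℝ :=
  if r.neg then x r.i + x r.j else x r.i - x r.j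

/-- The reflection as a linear map: `(i j)` exchanges the coordinates `x_i` and `x_j`, and `(i j)₋`
replaces `x_i` by `-x_j` and `x_j` by `-x_i`. -/
def Refl.map (r : Refl) : Space →ₗ[ℝ] Space where
  toFun x k :=
    if k = r.i then (if r.neg then -x r.j else x r.j)
    else if k = r.j then (if r.neg then -x r.i else x r.i)
    else x k
  map_add' x y := by
    funext k
    simp only [Pi.add_apply]
    split_ifs <;> ring
  map_smul' c x := by
    funext k
    simp only [Pi.smul_apply, smul_eq_mul, RingHom.id_apply]
    split_ifs <;> ring

theorem Refl.map_involutive (r : Refl) : Function.Involutive r.map := by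
  intro x
  funext k
  have h : r.j ≠ r.i := ne_of_gt r.lt
  by_cases h1 : k = r.i
  · subst h1
    cases hn : r.neg <;> simp [Refl.map, h, hn]
  · by_cases h2 : k = r.j
    · subst h2
      cases hn : r.neg <;> simp [Refl.map, h, hn]
    · simp [Refl.map, h1, h2]

/-- The reflection as an invertible linear map. -/
def Refl.equiv (r : Refl) : Space ≃ₗ[ℝ] Space :=
  LinearEquiv.ofInvolutive r.map r.map_involutive

/-- The group `𝒟`, generated by all `(i j)` and all `(i j)₋`. -/
def D : Subgroup (Space ≃ₗ[ℝ] Space) :=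
  Subgroup.closure (Set.range Refl.equiv)

/-- The point `v₋ = (-1, -2, -3, …)`. -/
def vMinus : Space := fun k => -((k : ℕ) : ℝ)

/-- The set of points that lie, for every reflection hyperplane in `R`, strictly on the same side
as `x`. -/
def cell (R : Set Refl) (x : Space) : Set Space :=
  {y | ∀ r ∈ R, 0 < r.form x * r.form y}

/-- The fundamental alcove `C'`: the chamber of `𝒟` that contains `v₋`. -/
def fundAlcove : Set Space := cell Set.univ vMinus

/-- The fundamental chamber `C₀` of the parabolic `𝒟₊ = ⟨(i j)⟩`: its hyperplanes are those of the
reflections `(i j)`, and `C₀` is the set of strictly descending sequences. -/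
def fundChamber : Set Space := cell {r | r.neg = false} vMinus

/-- Alcoves: the images `w C'` with `w ∈ 𝒟`. -/
def IsAlcove (A : Set Space) : Prop := ∃ w ∈ D, A = w '' fundAlcove

/-- The set `X⁺` of dominant alcoves, those that lie in `C₀`. -/
abbrev DomAlcove : Type := {A : Set Space // IsAlcove A ∧ A ⊆ fundChamber}

/-- The number of reflection hyperplanes that separate `A` from `C'`. -/
def length (A : Set Space) : ℕ :=
  Set.ncard {r : Refl | ∀ x ∈ A, ∀ y ∈ fundAlcove, r.form x * r.form y < 0}

/-- The reflection `t` is simple for `A`: its hyperplane makes a wall of `A`, that is, the closure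
of `A` contains a point of this hyperplane that lies on no other reflection hyperplane. -/
def IsWall (t : Refl) (A : Set Space) : Prop :=
  ∃ x ∈ closure A, t.form x = 0 ∧ ∀ r : Refl, r ≠ t → r.form x ≠ 0

/-- Edges `(A, B)` of the digraph `G_a` on dominant alcoves. -/
def Edge (A B : DomAlcove) : Prop :=
  (∃ t : Refl, IsWall t A.1 ∧ B.1 = t.equiv '' A.1) ∧ length B.1 = length A.1 + 1

/-- The strict order on `X⁺` defined by the acyclic digraph. -/
def Lt (A B : DomAlcove) : Prop := Relation.TransGen Edge A B

theorem Edge.length_lt {A B : DomAlcove} (h : Edge A B) : length A.1 < length B.1 := by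
  have := h.2
  omega

theorem Lt.length_lt {A B : DomAlcove} (h : Lt A B) : length A.1 < length B.1 := by
  induction h with
  | single h => exact h.length_lt
  | tail _ h ih => exact ih.trans h.length_lt

/-- The pair `(A', B')` lies in the `𝒟`-orbit of the pair `(A, B)`. -/
def SameOrbit (A B A' B' : DomAlcove) : Prop :=
  ∃ w ∈ D, A'.1 = w '' A.1 ∧ B'.1 = w '' B.1

/-! ### Parabolic Kazhdan–Lusztig polynomials of `𝒟/𝒟₊`

Polynomials in `v` are regarded as Laurent polynomials over `ℤ`, with `v = T 1`. -/

/-- The row `p'_A`, computed from the row `p = p_B` along an edge `(B, A)`. In the first sum `D'` is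
the lower end of an edge `(D', D)` in the orbit of `(B, A)`; in the second sum `D'` is the upper end
of an edge `(D, D')` in this orbit. -/
def preRow (B A : DomAlcove) (p : DomAlcove → ℤ[T;T⁻¹]) (E : DomAlcove) : ℤ[T;T⁻¹] :=
  (∑ᶠ E' ∈ {E' : DomAlcove | Edge E' E ∧ SameOrbit B A E' E},
      (LaurentPolynomial.T (-1) * p E + p E')) +
  (∑ᶠ E' ∈ {E' : DomAlcove | Edge E E' ∧ SameOrbit B A E E'},
      (LaurentPolynomial.T 1 * p E + p E'))

/-- A choice of one edge `(B, A)` for each `A` at which some edge ends. -/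
abbrev EdgeChoice : Type := ∀ A : DomAlcove, (∃ B, Edge B A) → {B : DomAlcove // Edge B A}

open Classical in
/-- The row `p_A` of the array of parabolic Kazhdan–Lusztig polynomials, computed recursively with
the edges chosen by `c`. At the root the row is `p_{A,A} = 1`, `p_{A,E} = 0` for `E ≠ A`. Otherwise
`p_A = p'_A - ∑_{F < A} p'_A(F)(v = 0) p_F`, where the value at `v = 0` is the constant
coefficient. -/
def pKL (c : EdgeChoice) (A : DomAlcove) : DomAlcove → ℤ[T;T⁻¹] :=
  if h : ∃ B, Edge B A then
    fun E =>
      preRow (c A h).1 A (pKL c (c A h).1) E -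
        ∑ᶠ F : {F : DomAlcove // Lt F A},
          LaurentPolynomial.C ((preRow (c A h).1 A (pKL c (c A h).1) F.1).coeff 0) *
            pKL c F.1 E
  else Pi.single A 1
termination_by length A.1
decreasing_by
  all_goals first
    | exact (c A h).2.length_lt
    | exact F.2.length_lt

/-- The label of a dominant alcove: the set of positive entries of the point of the orbit `𝒟 v₋`
inside the alcove. -/
def label (A : DomAlcove) : Set ℕ+ :=
  {n | ∃ w ∈ D, w vMinus ∈ A.1 ∧ ∃ k : ℕ+, w vMinus k = ((n : ℕ) : ℝ)}

/-! ### Temperley–Lieb arcs and hypercubes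

An arc with ends `i < j` is the pair `(i, j)`. A finite set `a` is identified with the binary
sequence that has a 1 in position `i` exactly if `i ∈ a`. -/

/-- The vertex `k` is an end of one of the arcs in `S`. -/
def Covered (S : Set (ℕ+ × ℕ+)) (k : ℕ+) : Prop := ∃ p ∈ S, k = p.1 ∨ k = p.2

/-- The 01-arcs drawn in the first `n` rounds: each round ignores the vertices that are already
paired and joins every 0 to a 1 that follows it immediately in the remaining sequence. -/
def arcs01 (a : Finset ℕ+) : ℕ → Set (ℕ+ × ℕ+)
  | 0 => ∅
  | n + 1 => arcs01 a n ∪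
      {p | p.1 < p.2 ∧ p.1 ∉ a ∧ p.2 ∈ a ∧
        ¬ Covered (arcs01 a n) p.1 ∧ ¬ Covered (arcs01 a n) p.2 ∧
        ∀ k, p.1 < k → k < p.2 → Covered (arcs01 a n) k}

/-- The positions of the 1s that remain when no 01-arc can be added. -/
def freeOnes (a : Finset ℕ+) : Set ℕ+ :=
  {k | k ∈ a ∧ ∀ n, ¬ Covered (arcs01 a n) k}

/-- The 11-arcs: the remaining 1s are joined in adjacent pairs from the left. -/
def arcs11 (a : Finset ℕ+) : Set (ℕ+ × ℕ+) :=
  {p | p.1 < p.2 ∧ p.1 ∈ freeOnes a ∧ p.2 ∈ freeOnes a ∧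
    (∀ k ∈ freeOnes a, ¬ (p.1 < k ∧ k < p.2)) ∧
    Even (Set.ncard {k ∈ freeOnes a | k < p.1})}

/-- The set `Γ^a` of all arcs of the TL-diagram of `a`. -/
def arcs (a : Finset ℕ+) : Set (ℕ+ × ℕ+) := (⋃ n, arcs01 a n) ∪ arcs11 a

/-- `b` is a vertex of the hypercube `h^a` at depth `d`: it is obtained from `a` by the
transformations 01 → 10 and 11 → 00 at the ends of each of `d` arcs of `Γ^a`. As the arcs have no
ends in common, this toggles all the ends of these arcs. -/
def AtDepth (a b : Finset ℕ+) (d : ℕ) : Prop :=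
  ∃ S : Finset (ℕ+ × ℕ+), (S : Set (ℕ+ × ℕ+)) ⊆ arcs a ∧ S.card = d ∧
    b = symmDiff a (S.biUnion fun p => {p.1, p.2})

end

end DKL

/-!
Read a binary sequence as a lattice path that starts at height `0`, rises at each 0 and falls at
each 1, except that a 1 met at height `0` makes it rise. Then the arcs of both kinds are exactly the
excursions of this path. A dominant alcove `w C'` is determined by the positive entries of `w v₋`,
and an edge multiplies `w` on the right by a simple reflection, which adds `1` and `2` to the label
or replaces `k` by `k + 1` in it. On the path this flattens a peak or raises a valley, so that the
matching formed by the arcs is reconnected: the two toggled positions are joined, and so are their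
former partners. Given a matching, let the weight of a set of positions be `v ^ d` if the set is the
union of `d` pairs of the matching, and `0` otherwise. These weights obey, under reconnection, the
recursion for `p'_A`. As no weight off the diagonal has a constant term, nothing is subtracted from
`p'_A`.
-/

namespace DKL

/-! ### Excursions of lattice paths -/

/-- A lattice path: any two consecutive heights differ by one. -/
def IsPath (g : ℕ → ℕ) : Prop := ∀ n, g (n + 1) = g n + 1 ∨ g n = g (n + 1) + 1

/-- An excursion of the path `g`: it leaves the height `g m` upwards at time `m` and is back at this
height for the first time at time `n`. -/
def IsExcursion (g : ℕ → ℕ) (m n : ℕ) : Prop :=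
  m < n ∧ g n = g m ∧ ∀ l, m < l → l < n → g m < g l

section Excursion
variable {g : ℕ → ℕ} {m m' n n' : ℕ}

theorem IsExcursion.right_unique (h : IsExcursion g m n) (h' : IsExcursion g m n') : n = n' := by
  obtain ⟨hlt, heq, hin⟩ := h
  obtain ⟨hlt', heq', hin'⟩ := h'
  rcases lt_trichotomy n n' with hn | hn | hn
  · have := hin' n hlt hn
    omega
  · exact hn
  · have := hin n' hlt' hn
    omega

theorem IsExcursion.left_unique (h : IsExcursion g m n) (h' : IsExcursion g m' n) : m = m' := by
  obtain ⟨hlt, heq, hin⟩ := h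
  obtain ⟨hlt', heq', hin'⟩ := h'
  rcases lt_trichotomy m m' with hm | hm | hm
  · have := hin m' hm hlt'
    omega
  · exact hm
  · have := hin' m hm hlt
    omega

theorem IsExcursion.height_succ (hg : IsPath g) (h : IsExcursion g m n) :
    g (m + 1) = g m + 1 := by
  obtain ⟨hlt, heq, hin⟩ := h
  have hstep := hg m
  rcases eq_or_lt_of_le (show m + 1 ≤ n from hlt) with rfl | hlt
  · omega
  · have := hin (m + 1) m.lt_succ_self hlt
    omega

theorem IsExcursion.height_pred (hg : IsPath g) (h : IsExcursion g m n) :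
    g (n - 1) = g n + 1 := by
  obtain ⟨hlt, heq, hin⟩ := h
  have hstep := hg (n - 1)
  rw [Nat.sub_add_cancel (by omega)] at hstep
  rcases eq_or_lt_of_le (Nat.le_sub_one_of_lt hlt) with rfl | hlt
  · omega
  · have := hin (n - 1) hlt (by omega)
    omega

theorem exists_isExcursion_from (hg : IsPath g) (hup : g m < g (m + 1)) (hmn : m < n)
    (hle : g n ≤ g m) : ∃ d ≤ n, IsExcursion g m d := by
  classical
  have hex : ∃ d, m < d ∧ g d ≤ g m := ⟨n, hmn, hle⟩
  obtain ⟨d, ⟨hmd, hd⟩, hmin⟩ : ∃ d, (m < d ∧ g d ≤ g m) ∧ ∀ l < d, ¬ (m < l ∧ g l ≤ g m) :=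
    ⟨Nat.find hex, Nat.find_spec hex, fun _ => Nat.find_min hex⟩
  have hin : ∀ l, m < l → l < d → g m < g l := fun l hml hl =>
    not_le.1 fun hc => hmin l hl ⟨hml, hc⟩
  have hne : d ≠ m + 1 := fun h => by
    subst h
    omega
  have hpred := hin (d - 1) (by omega) (by omega)
  have hstep := hg (d - 1)
  rw [Nat.sub_add_cancel (by omega)] at hstep
  exact ⟨d, not_lt.1 fun hnd => hmin n hnd ⟨hmn, hle⟩, hmd, by omega, hin⟩

theorem exists_isExcursion_to (hg : IsPath g) (hdown : g n < g (n - 1)) (hmn : m < n)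
    (hle : g m ≤ g n) : ∃ d, m ≤ d ∧ IsExcursion g d n := by
  classical
  obtain ⟨d, hmd, hdn, hd, hin⟩ : ∃ d, m ≤ d ∧ d ≤ n - 1 ∧ g d ≤ g n ∧
      ∀ l, d < l → l ≤ n - 1 → ¬ g l ≤ g n :=
    ⟨Nat.findGreatest (fun l => g l ≤ g n) (n - 1),
      Nat.le_findGreatest (Nat.le_sub_one_of_lt hmn) hle, Nat.findGreatest_le _,
      Nat.findGreatest_spec (P := fun l => g l ≤ g n) (Nat.le_sub_one_of_lt hmn) hle,
      fun _ => Nat.findGreatest_is_greatest⟩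
  have hne : d ≠ n - 1 := fun h => by
    subst h
    omega
  have hsucc := hin (d + 1) (by omega) (by omega)
  have hstep := hg d
  refine ⟨d, hmd, by omega, by omega, fun l hdl hln => ?_⟩
  have := hin l hdl (by omega)
  omega

end Excursion

/-! ### The path of a binary sequence -/

/-- The reflected lattice path of `a`: a 0 is a step up, and a 1 is a step down, except that at
height 0 it is a step up as well. It is designed so that both kinds of arcs become excursions. -/
def height (a : Finset ℕ+) : ℕ → ℕ
  | 0 => 0
  | n + 1 => if n.succPNat ∈ a ∧ height a n ≠ 0 then height a n - 1 else height a n + 1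

/-- The arc from `i` to `j`: an excursion of the path of `a` that begins with step `i` and ends with
step `j`. -/
def IsArc (a : Finset ℕ+) (i j : ℕ+) : Prop := IsExcursion (height a) (i - 1) j

section Height
variable {a : Finset ℕ+} {i i' j j' k : ℕ+}

theorem isPath_height (a : Finset ℕ+) : IsPath (height a) := by
  intro n
  rw [height]
  split_ifs with h <;> omega

theorem height_of_notMem (hk : k ∉ a) : height a k = height a (k - 1) + 1 := by
  obtain ⟨n, rfl⟩ : ∃ n : ℕ, k = n.succPNat := ⟨k.natPred, by simp⟩
  simp [height, hk]

theorem height_of_mem (hk : k ∈ a) :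
    height a (k - 1) = 0 ∧ height a k = 1 ∨ height a (k - 1) = height a k + 1 := by
  obtain ⟨n, rfl⟩ : ∃ n : ℕ, k = n.succPNat := ⟨k.natPred, by simp⟩
  simp only [height, Nat.succPNat_coe, Nat.succ_eq_add_one, Nat.add_sub_cancel, hk, true_and]
  split_ifs <;> omega

theorem IsArc.height_left (h : IsArc a i j) : height a i = height a (i - 1) + 1 := by
  have := IsExcursion.height_succ (isPath_height a) h
  rwa [Nat.sub_add_cancel i.pos] at this

theorem IsArc.height_right (h : IsArc a i j) : height a (j - 1) = height a j + 1 :=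
  IsExcursion.height_pred (isPath_height a) h

theorem IsArc.lt (h : IsArc a i j) : i < j := by
  refine lt_of_le_of_ne (?_ : (i : ℕ) ≤ j) fun hij => ?_
  · have := h.1
    omega
  · have := h.height_left
    have := h.height_right
    subst hij
    omega

theorem IsArc.coe_lt (h : IsArc a i j) : (i : ℕ) < j := h.lt

theorem IsArc.lt_height (h : IsArc a i j) {n : ℕ} (hin : i ≤ n) (hnj : n < j) :
    height a (i - 1) < height a n :=
  h.2.2 n (by have := i.pos; omega) hnj

theorem IsArc.right_mem (h : IsArc a i j) : j ∈ a := by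
  by_contra hj
  have := height_of_notMem hj
  have := h.height_right
  omega

theorem IsArc.height_eq_zero (h : IsArc a i j) (hi : i ∈ a) : height a (i - 1) = 0 := by
  have := height_of_mem hi
  have := h.height_left
  omega

theorem IsArc.right_unique (h : IsArc a i j) (h' : IsArc a i j') : j = j' :=
  PNat.coe_injective (IsExcursion.right_unique h h')

theorem IsArc.left_unique (h : IsArc a i j) (h' : IsArc a i' j) : i = i' := by
  have := IsExcursion.left_unique h h'
  have := i.pos
  have := i'.pos
  exact PNat.coe_injective (by omega)

theorem IsArc.not_isArc (h : IsArc a i j) : ¬ IsArc a j k := fun h' => by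
  have := h.height_right
  have := h'.height_left
  omega

theorem exists_isArc_from (hk : height a (k - 1) < height a k) {n : ℕ} (hn : (k : ℕ) ≤ n)
    (hle : height a n ≤ height a (k - 1)) : ∃ j : ℕ+, IsArc a k j ∧ (j : ℕ) ≤ n := by
  have hk0 := k.pos
  obtain ⟨d, hdn, hd⟩ := exists_isExcursion_from (isPath_height a) (m := k - 1) (n := n)
    (by rwa [Nat.sub_add_cancel hk0]) (by omega) hle
  exact ⟨⟨d, Nat.zero_lt_of_lt hd.1⟩, hd, hdn⟩

theorem exists_isArc_to (hk : height a k < height a (k - 1)) {n : ℕ} (hn : n < k)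
    (hle : height a n ≤ height a k) : ∃ i : ℕ+, IsArc a i k ∧ n < (i : ℕ) := by
  obtain ⟨d, hnd, hd⟩ := exists_isExcursion_to (isPath_height a) hk hn hle
  exact ⟨d.succPNat, hd, Nat.lt_succ_of_le hnd⟩

end Height

/-! ### Arcs of the diagram -/

section Arcs
variable {a : Finset ℕ+} {i j k : ℕ+} {n : ℕ} {p : ℕ+ × ℕ+}

theorem arcs01_mono (a : Finset ℕ+) : Monotone (arcs01 a) :=
  monotone_nat_of_le_succ fun _ _ h => Or.inl h

theorem Covered.mono {S T : Set (ℕ+ × ℕ+)} (h : S ⊆ T) : Covered S k → Covered T k :=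
  fun ⟨p, hp, hk⟩ => ⟨p, h hp, hk⟩

theorem notMem_of_mem_arcs01 (hp : p ∈ arcs01 a n) : p.1 ∉ a := by
  induction n with
  | zero => exact hp.elim
  | succ n ih => exact hp.elim ih fun hp => hp.2.1

theorem covered_of_mem_arcs01 (hp : p ∈ arcs01 a n) (h1 : p.1 < k) (h2 : k < p.2) :
    Covered (arcs01 a n) k := by
  induction n with
  | zero => exact hp.elim
  | succ n ih =>
    rcases hp with hp | ⟨-, -, -, -, -, hb⟩
    · exact (ih hp).mono (arcs01_mono a n.le_succ)
    · exact (hb k h1 h2).mono (arcs01_mono a n.le_succ)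

/-- Arcs of earlier rounds do not cross a new one, since the vertices that they enclose are
covered. -/
theorem exists_mem_arcs01_between (hi : ¬ Covered (arcs01 a n) i) (hj : ¬ Covered (arcs01 a n) j)
    (hb : ∀ k, i < k → k < j → Covered (arcs01 a n) k) (hik : i < k) (hkj : k < j) :
    ∃ q ∈ arcs01 a n, i < q.1 ∧ q.2 < j ∧ (k = q.1 ∨ k = q.2) := by
  obtain ⟨q, hq, hk⟩ := hb k hik hkj
  refine ⟨q, hq, ?_, ?_, hk⟩
  · rcases hk with rfl | rfl
    · exact hik
    · by_contra hle
      rcases (not_lt.1 hle).eq_or_lt with he | hlt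
      · exact hi ⟨q, hq, Or.inl he.symm⟩
      · exact hi (covered_of_mem_arcs01 hq hlt hik)
  · rcases hk with rfl | rfl
    · by_contra hle
      rcases (not_lt.1 hle).eq_or_lt with he | hlt
      · exact hj ⟨q, hq, Or.inr he⟩
      · exact hj (covered_of_mem_arcs01 hq hkj hlt)
    · exact hkj

theorem height_le_of_isArc_between
    (hb : ∀ k, i < k → k < j → ∃ p q, IsArc a p q ∧ i < p ∧ q < j ∧ (k = p ∨ k = q)) :
    ∀ n : ℕ, (i : ℕ) ≤ n → n < j → height a i ≤ height a n := by
  intro n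
  induction n using Nat.strong_induction_on with
  | _ n ih =>
    intro hin hnj
    rcases hin.eq_or_lt with rfl | hin
    · rfl
    obtain ⟨p, q, hpq, hip, -, hn⟩ := hb ⟨n, by omega⟩ hin hnj
    have hip : (i : ℕ) < p := hip
    have hlt := hpq.coe_lt
    have hleft := hpq.height_left
    rcases hn with hn | hn <;> replace hn : n = _ := congrArg PNat.val hn <;> subst hn
    · have := ih (p - 1) (by omega) (by omega) (by omega)
      omega
    · have := ih (p - 1) (by omega) (by omega) (by omega)
      rw [hpq.2.1]
      exact this

theorem height_pred_le_of_isArc_between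
    (hb : ∀ k, i < k → k < j → ∃ p q, IsArc a p q ∧ i < p ∧ q < j ∧ (k = p ∨ k = q)) :
    ∀ d n : ℕ, n + d = j - 1 → (i : ℕ) ≤ n → height a (j - 1) ≤ height a n := by
  intro d
  induction d using Nat.strong_induction_on with
  | _ d ih =>
    rintro n hnd hin
    rcases Nat.eq_zero_or_pos d with rfl | hd
    · rw [← hnd, add_zero]
    obtain ⟨p, q, hpq, -, hqj, hn⟩ := hb n.succPNat (Nat.lt_succ_of_le hin)
      (show n + 1 < (j : ℕ) by omega)
    have hqj : (q : ℕ) < j := hqj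
    have hlt := hpq.coe_lt
    rcases hn with hn | hn <;> replace hn : n + 1 = _ := congrArg PNat.val hn
    · have := ih (j - 1 - q) (by omega) q (by omega) (by omega)
      rwa [hpq.2.1, ← hn] at this
    · have := ih (d - 1) (by omega) q (by omega) (by omega)
      have := hpq.height_right
      rw [show n = q - 1 by omega]
      omega

theorem isArc_of_isArc_between (hij : i < j) (hi : i ∉ a) (hj : j ∈ a)
    (hb : ∀ k, i < k → k < j → ∃ p q, IsArc a p q ∧ i < p ∧ q < j ∧ (k = p ∨ k = q)) :
    IsArc a i j := by
  have hij : (i : ℕ) < j := hij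
  have hup := height_le_of_isArc_between hb
  have hdown := height_pred_le_of_isArc_between hb (j - 1 - i) i (by omega) le_rfl
  have := hup (j - 1) (by omega) (by omega)
  have := height_of_notMem hi
  have := height_of_mem hj
  refine ⟨by omega, by omega, fun n hin hnj => ?_⟩
  have := hup n (by omega) hnj
  omega

theorem isArc_of_mem_arcs01 (hp : p ∈ arcs01 a n) : IsArc a p.1 p.2 := by
  induction n generalizing p with
  | zero => exact hp.elim
  | succ n ih =>
    rcases hp with hp | ⟨hlt, hl, hr, hcl, hcr, hb⟩
    · exact ih hp
    refine isArc_of_isArc_between hlt hl hr fun k h1 h2 => ?_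
    obtain ⟨q, hq, h⟩ := exists_mem_arcs01_between hcl hcr hb h1 h2
    exact ⟨q.1, q.2, ih hq, h⟩

theorem IsArc.exists_isArc_between (h : IsArc a i j) (hik : i < k) (hkj : k < j) :
    ∃ p q, IsArc a p q ∧ p ∉ a ∧ i < p ∧ q < j ∧ (k = p ∨ k = q) := by
  have hik : (i : ℕ) < k := hik
  have hkj : (k : ℕ) < j := hkj
  have hpred := h.lt_height (n := k - 1) (by omega) (by omega)
  have hk := h.lt_height hik.le hkj
  by_cases hka : k ∈ a
  · have hstep := height_of_mem hka
    obtain ⟨p, hp, hip⟩ := exists_isArc_to (a := a) (k := k) (by omega) (n := i) hik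
      (by have := h.height_left; omega)
    refine ⟨p, k, hp, fun hpa => ?_, hip, hkj, Or.inr rfl⟩
    have := h.lt_height (n := p - 1) (by omega) (by have := hp.coe_lt; omega)
    have := hp.height_eq_zero hpa
    omega
  · have hstep := height_of_notMem hka
    obtain ⟨q, hq, hqj⟩ := exists_isArc_from (a := a) (k := k) (by omega) (n := j - 1) (by omega)
      (by have := h.height_right; have := h.2.1; omega)
    exact ⟨k, q, hq, hka, hik, (by omega : (q : ℕ) < j), Or.inl rfl⟩

theorem IsArc.mem_arcs01 (h : IsArc a i j) (hi : i ∉ a) : (i, j) ∈ arcs01 a (j - i) := by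
  obtain ⟨d, hd⟩ : ∃ d, d = (j : ℕ) - i := ⟨_, rfl⟩
  induction d using Nat.strong_induction_on generalizing i j with
  | _ d ih =>
    have hij := h.coe_lt
    rw [← hd, ← Nat.sub_add_cancel (show 1 ≤ d by omega)]
    by_cases hc : Covered (arcs01 a (d - 1)) i ∨ Covered (arcs01 a (d - 1)) j
    · refine arcs01_mono a (Nat.le_succ _) ?_
      rcases hc with ⟨⟨p, q⟩, hq, rfl | rfl⟩ | ⟨⟨p, q⟩, hq, rfl | rfl⟩ <;>
        have hpq := isArc_of_mem_arcs01 hq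
      · rwa [h.right_unique hpq]
      · exact (hi hpq.right_mem).elim
      · exact (h.not_isArc hpq).elim
      · rwa [h.left_unique hpq]
    · rw [not_or] at hc
      refine Or.inr ⟨h.lt, hi, h.right_mem, hc.1, hc.2, fun k hik hkj => ?_⟩
      obtain ⟨p, q, hpq, hp, hip, hqj, hk⟩ := h.exists_isArc_between hik hkj
      have hip : (i : ℕ) < p := hip
      have hqj : (q : ℕ) < j := hqj
      have hlt := hpq.coe_lt
      exact ⟨(p, q), arcs01_mono a (by omega) (ih (q - p) (by omega) hpq hp rfl), hk⟩

theorem mem_iUnion_arcs01 : (i, j) ∈ ⋃ n, arcs01 a n ↔ IsArc a i j ∧ i ∉ a := by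
  rw [Set.mem_iUnion]
  exact ⟨fun ⟨_, h⟩ => ⟨isArc_of_mem_arcs01 h, notMem_of_mem_arcs01 h⟩,
    fun h => ⟨_, h.1.mem_arcs01 h.2⟩⟩

theorem mem_freeOnes : k ∈ freeOnes a ↔ k ∈ a ∧ ∀ i, IsArc a i k → i ∈ a := by
  refine and_congr_right fun hk => ⟨fun h i hi => ?_, fun h n ⟨q, hq, hkq⟩ => ?_⟩
  · by_contra hia
    exact h _ ⟨_, hi.mem_arcs01 hia, Or.inr rfl⟩
  · have hq' := notMem_of_mem_arcs01 hq
    rcases hkq with rfl | rfl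
    · exact hq' hk
    · exact hq' (h _ (isArc_of_mem_arcs01 hq))

end Arcs

section FreeOnes
variable {a : Finset ℕ+} {i j k : ℕ+} {n : ℕ}

theorem mem_freeOnes_of_height_eq_zero (hk : k ∈ a) (h0 : height a (k - 1) = 0) :
    k ∈ freeOnes a :=
  mem_freeOnes.2 ⟨hk, fun i hi => by
    have := hi.height_right
    omega⟩

theorem IsArc.right_mem_freeOnes (h : IsArc a i j) (hi : i ∈ a) : j ∈ freeOnes a :=
  mem_freeOnes.2 ⟨h.right_mem, fun _ h' => h'.left_unique h ▸ hi⟩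

theorem exists_isArc_of_mem (hk : k ∈ a) (h0 : height a (k - 1) ≠ 0) : ∃ i, IsArc a i k := by
  have := height_of_mem hk
  obtain ⟨i, hi, -⟩ := exists_isArc_to (a := a) (k := k) (by omega) k.pos (Nat.zero_le _)
  exact ⟨i, hi⟩

theorem height_eq_zero_or_exists_of_mem_freeOnes (hk : k ∈ freeOnes a) :
    height a (k - 1) = 0 ∨ ∃ i ∈ a, IsArc a i k := by
  rw [mem_freeOnes] at hk
  refine or_iff_not_imp_left.2 fun h0 => ?_
  obtain ⟨i, hi⟩ := exists_isArc_of_mem hk.1 h0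
  exact ⟨i, hk.2 i hi, hi⟩

/-- After `n` steps, a remaining 1 is still waiting for its partner in an 11-arc. -/
def IsPending (a : Finset ℕ+) (n : ℕ) : Prop :=
  ∃ i ∈ a, (i : ℕ) ≤ n ∧ height a (i - 1) = 0 ∧ ∀ m, (i : ℕ) ≤ m → m ≤ n → 0 < height a m

theorem not_isPending_of_height_eq_zero (h0 : height a n = 0) : ¬ IsPending a n :=
  fun ⟨_, _, hin, _, hpos⟩ => (hpos n hin le_rfl).ne' h0

theorem isPending_iff_pred (hpos : IsPending a (k - 1) → 0 < height a k)
    (hk : k ∈ a → height a (k - 1) ≠ 0) : IsPending a k ↔ IsPending a (k - 1) := by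
  have hk0 := k.pos
  constructor
  · rintro ⟨i, hi, hik, h0, h⟩
    have hne : (i : ℕ) ≠ k := fun he => hk (PNat.coe_injective he ▸ hi) (he ▸ h0)
    exact ⟨i, hi, by omega, h0, fun m h1 h2 => h m h1 (by omega)⟩
  · intro hp
    obtain ⟨i, hi, hik, h0, h⟩ := id hp
    refine ⟨i, hi, by omega, h0, fun m h1 h2 => ?_⟩
    rcases h2.eq_or_lt with rfl | h2
    · exact hpos hp
    · exact h m h1 (by omega)

theorem isPending_iff (k : ℕ+) : IsPending a k ↔ (IsPending a (k - 1) ↔ k ∉ freeOnes a) := by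
  by_cases hk : k ∈ a
  · by_cases h0 : height a (k - 1) = 0
    · have h1 : 0 < height a k := by
        have := height_of_mem hk
        omega
      have hpend : IsPending a k :=
        ⟨k, hk, le_rfl, h0, fun m h h' => le_antisymm h h' ▸ h1⟩
      have := not_isPending_of_height_eq_zero h0
      have := mem_freeOnes_of_height_eq_zero hk h0
      tauto
    obtain ⟨i, hi⟩ := exists_isArc_of_mem hk h0
    by_cases hia : i ∈ a
    · have hi0 := hi.height_eq_zero hia
      have hlt := hi.coe_lt
      have hpend : IsPending a (k - 1) :=
        ⟨i, hia, by omega, hi0, fun m h h' => hi0 ▸ hi.lt_height h (by omega)⟩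
      have := not_isPending_of_height_eq_zero (hi.2.1.trans hi0)
      have := hi.right_mem_freeOnes hia
      tauto
    · have hfree : k ∉ freeOnes a := fun h => hia ((mem_freeOnes.1 h).2 i hi)
      rw [isPending_iff_pred _ fun _ => h0]
      · tauto
      · rintro ⟨i', hi', hik, hi0, h⟩
        refine Nat.pos_of_ne_zero fun hk0 => hia ?_
        have harc : IsArc a i' k := ⟨by have := i'.pos; omega, hk0.trans hi0.symm,
          fun m h1 h2 => hi0 ▸ h m (by omega) (by omega)⟩
        exact harc.left_unique hi ▸ hi'
  · have hfree : k ∉ freeOnes a := fun h => hk (mem_freeOnes.1 h).1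
    have := height_of_notMem hk
    rw [isPending_iff_pred (fun _ => by omega) fun h => (hk h).elim]
    tauto

theorem even_ncard_freeOnes_iff (n : ℕ) :
    Even (Set.ncard {k ∈ freeOnes a | (k : ℕ) ≤ n}) ↔ ¬ IsPending a n := by
  induction n with
  | zero =>
    have := not_isPending_of_height_eq_zero (a := a) (n := 0) rfl
    simp [this]
  | succ n ih =>
    have hfin : {k ∈ freeOnes a | (k : ℕ) ≤ n}.Finite :=
      a.finite_toSet.subset fun k hk => hk.1.1
    have hpend := isPending_iff (a := a) n.succPNat
    simp only [Nat.succPNat_coe, Nat.succ_eq_add_one, Nat.add_sub_cancel] at hpend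
    rw [hpend]
    by_cases hfree : n.succPNat ∈ freeOnes a
    · have hinsert : {k ∈ freeOnes a | (k : ℕ) ≤ n + 1} =
          insert n.succPNat {k ∈ freeOnes a | (k : ℕ) ≤ n} := by
        ext k
        have : k = n.succPNat ↔ (k : ℕ) = n + 1 := PNat.coe_inj.symm
        simp only [Set.mem_insert_iff, Set.mem_ofPred_eq, this]
        grind
      rw [hinsert, Set.ncard_insert_of_notMem (by simp) hfin, Nat.even_add_one, ih]
      tauto
    · have hsame : {k ∈ freeOnes a | (k : ℕ) ≤ n + 1} = {k ∈ freeOnes a | (k : ℕ) ≤ n} := by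
        ext k
        have : k = n.succPNat ↔ (k : ℕ) = n + 1 := PNat.coe_inj.symm
        simp only [Set.mem_ofPred_eq]
        grind
      rw [hsame, ih]
      tauto

theorem even_ncard_freeOnes_lt_iff (k : ℕ+) :
    Even (Set.ncard {l ∈ freeOnes a | l < k}) ↔ ¬ IsPending a (k - 1) := by
  rw [← even_ncard_freeOnes_iff]
  have hlt : ∀ l : ℕ+, l < k ↔ (l : ℕ) ≤ k - 1 := fun l => by
    rw [← PNat.coe_lt_coe]
    have := k.pos
    omega
  simp only [hlt]

theorem IsArc.mem_arcs11 (h : IsArc a i j) (hi : i ∈ a) : (i, j) ∈ arcs11 a := by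
  have h0 := h.height_eq_zero hi
  refine ⟨h.lt, mem_freeOnes_of_height_eq_zero hi h0, h.right_mem_freeOnes hi, ?_,
    (even_ncard_freeOnes_lt_iff i).2 (not_isPending_of_height_eq_zero h0)⟩
  rintro k hk ⟨hik, hkj⟩
  have hik : (i : ℕ) < k := hik
  have hkj : (k : ℕ) < j := hkj
  rcases height_eq_zero_or_exists_of_mem_freeOnes hk with hk0 | ⟨l, hl, hlk⟩
  · have := h.lt_height (n := k - 1) (by omega) (by omega)
    omega
  · have := h.lt_height hik.le hkj
    have := hlk.height_eq_zero hl
    have := hlk.2.1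
    omega

theorem isArc_of_mem_arcs11 (h : (i, j) ∈ arcs11 a) : IsArc a i j ∧ i ∈ a := by
  obtain ⟨hij, hi, hj, hb, he⟩ := h
  dsimp only at hij hi hj hb he
  refine ⟨?_, (mem_freeOnes.1 hi).1⟩
  have hij' : (i : ℕ) < j := hij
  have hi0 : height a (i - 1) = 0 := by
    rw [even_ncard_freeOnes_lt_iff] at he
    refine (height_eq_zero_or_exists_of_mem_freeOnes hi).resolve_right fun ⟨l, hl, hli⟩ => he ?_
    have h0 := hli.height_eq_zero hl
    have hlt := hli.coe_lt
    exact ⟨l, hl, by omega, h0, fun m h1 h2 => h0 ▸ hli.lt_height h1 (by omega)⟩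
  have hup := height_of_mem (mem_freeOnes.1 hi).1
  rcases height_eq_zero_or_exists_of_mem_freeOnes hj with hj0 | ⟨l, hl, hlj⟩
  · obtain ⟨k, hik, hkj⟩ := exists_isArc_from (a := a) (k := i) (by omega) (n := j - 1)
      (by omega) (by omega)
    refine (hb k (hik.right_mem_freeOnes (mem_freeOnes.1 hi).1) ⟨hik.lt, ?_⟩).elim
    exact (by omega : (k : ℕ) < j)
  · have hl0 := hlj.height_eq_zero hl
    have hli : ¬ l < i := fun hli => by
      have hli : (l : ℕ) < i := hli
      have := hlj.lt_height (n := i - 1) (by omega) (by omega)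
      omega
    have hil : ¬ i < l := fun hil =>
      hb l (mem_freeOnes_of_height_eq_zero hl hl0) ⟨hil, hlj.lt⟩
    exact le_antisymm (not_lt.1 hil) (not_lt.1 hli) ▸ hlj

theorem mem_arcs : (i, j) ∈ arcs a ↔ IsArc a i j := by
  rw [arcs, Set.mem_union, mem_iUnion_arcs01]
  constructor
  · rintro (h | h)
    exacts [h.1, (isArc_of_mem_arcs11 h).1]
  · intro h
    by_cases hi : i ∈ a
    exacts [Or.inr (h.mem_arcs11 hi), Or.inl ⟨h, hi⟩]

end FreeOnes

/-! ### Matchings -/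

section Matching
variable {V : Type*} {M N : V → V → Prop} {x y : V} {u : Finset V}

/-- The relation `M` is a matching: it pairs off some of the vertices. -/
structure IsMatching (M : V → V → Prop) : Prop where
  symm : ∀ {i j}, M i j → M j i
  unique : ∀ {i j j'}, M i j → M i j' → j = j'
  irrefl : ∀ i, ¬ M i i

/-- The relation obtained from the matching `M` by joining `x` to `y`, and the former partner of `x`
to that of `y` if they exist. -/
def Reconnect (M : V → V → Prop) (x y i j : V) : Prop :=
  (i = x ∧ j = y) ∨ (i = y ∧ j = x) ∨
    (i ≠ x ∧ i ≠ y ∧ j ≠ x ∧ j ≠ y ∧ (M i j ∨ (M i x ∧ M y j) ∨ (M i y ∧ M x j)))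

theorem IsMatching.ne_and_ne (hN : IsMatching N) (hxy : N x y) {i j : V} (hij : N i j)
    (hi : i ≠ x ∧ i ≠ y) : j ≠ x ∧ j ≠ y := by
  constructor <;> rintro rfl
  exacts [hi.2 (hN.unique (hN.symm hij) hxy), hi.1 (hN.unique (hN.symm hij) (hN.symm hxy))]

theorem IsMatching.eq_reconnect (hN : IsMatching N) (hxy : N x y)
    (h : ∀ i j, i ≠ x → i ≠ y → j ≠ x → j ≠ y →
      (N i j ↔ M i j ∨ (M i x ∧ M y j) ∨ (M i y ∧ M x j))) :
    N = Reconnect M x y := by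
  ext i j
  constructor
  · intro hij
    by_cases hi : i ≠ x ∧ i ≠ y
    · have hj := hN.ne_and_ne hxy hij hi
      exact Or.inr (Or.inr ⟨hi.1, hi.2, hj.1, hj.2, (h i j hi.1 hi.2 hj.1 hj.2).1 hij⟩)
    · rw [not_and_or, not_not, not_not] at hi
      rcases hi with rfl | rfl
      · exact Or.inl ⟨rfl, hN.unique hij hxy⟩
      · exact Or.inr (Or.inl ⟨rfl, hN.unique hij (hN.symm hxy)⟩)
  · rintro (⟨rfl, rfl⟩ | ⟨rfl, rfl⟩ | ⟨hix, hiy, hjx, hjy, hij⟩)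
    exacts [hxy, hN.symm hxy, (h i j hix hiy hjx hjy).2 hij]

theorem reconnect_iff_of_ne {i j : V} (hi : i ≠ x ∧ i ≠ y) (hj : j ≠ x ∧ j ≠ y) :
    Reconnect M x y i j ↔ M i j ∨ (M i x ∧ M y j) ∨ (M i y ∧ M x j) := by
  simp only [Reconnect, hi.1, hi.2, hj.1, hj.2, ne_eq, not_false_eq_true, true_and, false_and,
    false_or]

/-- The set `u` is a union of pairs of the matching `M`. -/
def Saturated (M : V → V → Prop) (u : Finset V) : Prop := ∀ i ∈ u, ∃ j ∈ u, M i j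

theorem not_saturated_reconnect_left (hx : x ∈ u) (hy : y ∉ u) :
    ¬ Saturated (Reconnect M x y) u := by
  intro h
  obtain ⟨j, hj, ⟨-, rfl⟩ | ⟨rfl, -⟩ | ⟨h, -⟩⟩ := h x hx
  exacts [hy hj, hy hx, h rfl]

theorem not_saturated_reconnect_right (hx : x ∉ u) (hy : y ∈ u) :
    ¬ Saturated (Reconnect M x y) u := by
  intro h
  obtain ⟨j, hj, ⟨rfl, -⟩ | ⟨-, rfl⟩ | ⟨-, h, -⟩⟩ := h y hy
  exacts [hx hy, hx hj, h rfl]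

theorem ne_and_ne_of_mem (hx : x ∉ u) (hy : y ∉ u) : ∀ i ∈ u, i ≠ x ∧ i ≠ y :=
  fun _ hi => ⟨ne_of_mem_of_not_mem hi hx, ne_of_mem_of_not_mem hi hy⟩

theorem Saturated.reconnect (hx : x ∉ u) (hy : y ∉ u) (h : Saturated M u) :
    Saturated (Reconnect M x y) u := by
  have hne := ne_and_ne_of_mem hx hy
  intro i hi
  obtain ⟨j, hj, hij⟩ := h i hi
  exact ⟨j, hj, (reconnect_iff_of_ne (hne i hi) (hne j hj)).2 (Or.inl hij)⟩

variable [DecidableEq V]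

theorem saturated_reconnect_insert (hx : x ∉ u) (hy : y ∉ u) :
    Saturated (Reconnect M x y) (insert x (insert y u)) ↔ Saturated (Reconnect M x y) u := by
  constructor
  · intro h i hi
    have hne := ne_and_ne_of_mem hx hy i hi
    obtain ⟨j, hj, hij⟩ := h i (by simp [hi])
    refine ⟨j, ?_, hij⟩
    rcases hij with ⟨hix, -⟩ | ⟨hiy, -⟩ | ⟨-, -, hjx, hjy, -⟩
    · exact (hne.1 hix).elim
    · exact (hne.2 hiy).elim
    · simpa [hjx, hjy] using hj
  · intro h i hi
    simp only [Finset.mem_insert] at hi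
    rcases hi with rfl | rfl | hi
    · exact ⟨y, by simp, Or.inl ⟨rfl, rfl⟩⟩
    · exact ⟨x, by simp, Or.inr (Or.inl ⟨rfl, rfl⟩)⟩
    · obtain ⟨j, hj, h⟩ := h i hi
      exact ⟨j, by simp [hj], h⟩

theorem Saturated.exists_partners (hM : IsMatching M) (hxy : ¬ M x y)
    (h : Saturated M (insert x (insert y u))) :
    (∃ i ∈ u, M x i) ∧ ∃ j ∈ u, M y j := by
  obtain ⟨i, hi, hxi⟩ := h x (by simp)
  obtain ⟨j, hj, hyj⟩ := h y (by simp)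
  simp only [Finset.mem_insert] at hi hj
  constructor
  · refine ⟨i, ?_, hxi⟩
    rcases hi with rfl | rfl | hi
    exacts [(hM.irrefl _ hxi).elim, (hxy hxi).elim, hi]
  · refine ⟨j, ?_, hyj⟩
    rcases hj with rfl | rfl | hj
    exacts [(hxy (hM.symm hyj)).elim, (hM.irrefl _ hyj).elim, hj]

theorem Saturated.not_saturated_of_insert (hM : IsMatching M) (hxy : ¬ M x y) (hx : x ∉ u)
    (h : Saturated M (insert x (insert y u))) : ¬ Saturated M u := by
  intro h'
  obtain ⟨⟨i, hi, hxi⟩, -⟩ := h.exists_partners hM hxy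
  obtain ⟨j, hj, hij⟩ := h' i hi
  exact hx (hM.unique hij (hM.symm hxi) ▸ hj)

theorem Saturated.reconnect_of_insert (hM : IsMatching M) (hxy : ¬ M x y) (hx : x ∉ u)
    (hy : y ∉ u) (h : Saturated M (insert x (insert y u))) : Saturated (Reconnect M x y) u := by
  have hne := ne_and_ne_of_mem hx hy
  intro i hi
  obtain ⟨⟨p, hp, hxp⟩, ⟨q, hq, hyq⟩⟩ := h.exists_partners hM hxy
  obtain ⟨j, hj, hij⟩ := h i (by simp [hi])
  simp only [Finset.mem_insert] at hj
  rcases hj with rfl | rfl | hj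
  · exact ⟨q, hq, (reconnect_iff_of_ne (hne i hi) (hne q hq)).2 (Or.inr (Or.inl ⟨hij, hyq⟩))⟩
  · exact ⟨p, hp, (reconnect_iff_of_ne (hne i hi) (hne p hp)).2 (Or.inr (Or.inr ⟨hij, hxp⟩))⟩
  · exact ⟨j, hj, (reconnect_iff_of_ne (hne i hi) (hne j hj)).2 (Or.inl hij)⟩

theorem Saturated.of_reconnect (hM : IsMatching M) (hx : x ∉ u) (hy : y ∉ u)
    (h : Saturated (Reconnect M x y) u) :
    Saturated M (insert x (insert y u)) ∨ Saturated M u := by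
  have hne := ne_and_ne_of_mem hx hy
  have hp : ∀ i ∈ u, ∃ j ∈ u, M i j ∨ (M i x ∧ M y j) ∨ (M i y ∧ M x j) := fun i hi =>
    (h i hi).imp fun j ⟨hj, hij⟩ => ⟨hj, (reconnect_iff_of_ne (hne i hi) (hne j hj)).1 hij⟩
  by_cases hc : ∃ i ∈ u, ∃ j ∈ u, M i x ∧ M y j
  · obtain ⟨i, hi, j, hj, hix, hyj⟩ := hc
    refine Or.inl fun k hk => ?_
    simp only [Finset.mem_insert] at hk
    rcases hk with rfl | rfl | hk
    · exact ⟨i, by simp [hi], hM.symm hix⟩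
    · exact ⟨j, by simp [hj], hyj⟩
    · obtain ⟨l, hl, hkl | ⟨hkx, -⟩ | ⟨hky, -⟩⟩ := hp k hk
      · exact ⟨l, by simp [hl], hkl⟩
      · exact ⟨x, by simp, hkx⟩
      · exact ⟨y, by simp, hky⟩
  · refine Or.inr fun i hi => ?_
    obtain ⟨j, hj, hij | ⟨hix, hyj⟩ | ⟨hiy, hxj⟩⟩ := hp i hi
    · exact ⟨j, hj, hij⟩
    · exact (hc ⟨i, hi, j, hj, hix, hyj⟩).elim
    · exact (hc ⟨j, hj, i, hi, hM.symm hxj, hM.symm hiy⟩).elim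

theorem saturated_reconnect (hM : IsMatching M) (hxy : ¬ M x y) (hx : x ∉ u) (hy : y ∉ u) :
    Saturated (Reconnect M x y) u ↔ Saturated M (insert x (insert y u)) ∨ Saturated M u :=
  ⟨Saturated.of_reconnect hM hx hy,
    fun h => h.elim (Saturated.reconnect_of_insert hM hxy hx hy) (Saturated.reconnect hx hy)⟩

end Matching

/-! ### Weights -/

section Weight

open scoped LaurentPolynomial

variable {V : Type*} {M : V → V → Prop} {x y : V} {u : Finset V}

open Classical in
/-- The weight `v ^ d` of a union `u` of `d` pairs of the matching `M`; other sets have weight 0. -/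
noncomputable def weight (M : V → V → Prop) (u : Finset V) : ℤ[T;T⁻¹] :=
  if Saturated M u then LaurentPolynomial.T ((u.card / 2 : ℕ) : ℤ) else 0

theorem weight_of_saturated (h : Saturated M u) :
    weight M u = LaurentPolynomial.T ((u.card / 2 : ℕ) : ℤ) := if_pos h

theorem weight_of_not_saturated (h : ¬ Saturated M u) : weight M u = 0 := if_neg h

variable [DecidableEq V]

theorem card_insert_insert_div_two (hx : x ∉ u) (hy : y ∉ u) (hne : x ≠ y) :
    (insert x (insert y u)).card / 2 = u.card / 2 + 1 := by
  rw [Finset.card_insert_of_notMem (by simp [hne, hx]), Finset.card_insert_of_notMem hy]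
  omega

theorem weight_reconnect (hM : IsMatching M) (hxy : ¬ M x y) (hx : x ∉ u) (hy : y ∉ u)
    (hne : x ≠ y) : weight (Reconnect M x y) u =
      LaurentPolynomial.T (-1) * weight M (insert x (insert y u)) + weight M u := by
  by_cases hins : Saturated M (insert x (insert y u))
  · rw [weight_of_saturated (hins.reconnect_of_insert hM hxy hx hy), weight_of_saturated hins,
      weight_of_not_saturated (hins.not_saturated_of_insert hM hxy hx),
      card_insert_insert_div_two hx hy hne, ← LaurentPolynomial.T_add, add_zero]
    congr 1
    push_cast
    ring
  rw [weight_of_not_saturated hins, mul_zero, zero_add]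
  by_cases hu : Saturated M u
  · rw [weight_of_saturated hu, weight_of_saturated (hu.reconnect hx hy)]
  · rw [weight_of_not_saturated hu, weight_of_not_saturated]
    rw [saturated_reconnect hM hxy hx hy]
    tauto

theorem weight_reconnect_insert (hM : IsMatching M) (hxy : ¬ M x y) (hx : x ∉ u) (hy : y ∉ u)
    (hne : x ≠ y) : weight (Reconnect M x y) (insert x (insert y u)) =
      LaurentPolynomial.T 1 * weight M u + weight M (insert x (insert y u)) := by
  have hmul : weight (Reconnect M x y) (insert x (insert y u)) =
      LaurentPolynomial.T 1 * weight (Reconnect M x y) u := by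
    have hs := saturated_reconnect_insert (M := M) hx hy
    by_cases hu : Saturated (Reconnect M x y) u
    · rw [weight_of_saturated hu, weight_of_saturated (hs.2 hu),
        card_insert_insert_div_two hx hy hne, ← LaurentPolynomial.T_add]
      congr 1
      push_cast
      ring
    · rw [weight_of_not_saturated hu, weight_of_not_saturated (hs.not.2 hu), mul_zero]
  rw [hmul, weight_reconnect hM hxy hx hy hne, mul_add, ← mul_assoc, ← LaurentPolynomial.T_add,
    add_neg_cancel, LaurentPolynomial.T_zero, one_mul, add_comm]

end Weight

/-! ### Moving an excursion -/

section Move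
variable {f g : ℕ → ℕ} {m s e : ℕ}

theorem isExcursion_congr (h : ∀ n, s ≤ n → n ≤ e → f n = g n) :
    IsExcursion f s e ↔ IsExcursion g s e := by
  by_cases hse : s ≤ e
  · simp only [IsExcursion, h s le_rfl hse, h e hse le_rfl]
    refine and_congr_right fun _ => and_congr_right fun _ => forall_congr' fun l => ?_
    refine forall_congr' fun hsl => forall_congr' fun hle => ?_
    rw [h l hsl.le hle.le]
  · exact iff_of_false (fun hf => hse hf.1.le) fun hg => hse hg.1.le

theorem IsExcursion.fill_valley (hne : ∀ n, n ≠ m + 1 → g n = f n) (hdown : f m = f (m + 1) + 1)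
    (hpeak : g (m + 1) = f m + 1) (hsm : s < m) (hme : m + 2 < e)
    (h : IsExcursion f s e ∨ (IsExcursion f s (m + 1) ∧ IsExcursion f (m + 1) e)) :
    IsExcursion g s e := by
  have hle : f s ≤ f (m + 1) := by
    rcases h with ⟨-, -, hin⟩ | ⟨⟨-, heq, -⟩, -⟩
    · exact (hin (m + 1) (by omega) (by omega)).le
    · exact heq.ge
  have heq : f e = f s := by
    rcases h with ⟨-, heq, -⟩ | ⟨⟨-, heq, -⟩, -, heq', -⟩
    exacts [heq, heq'.trans heq]
  simp only [IsExcursion, hne s (by omega), hne e (by omega)]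
  refine ⟨by omega, heq, fun l hsl hl => ?_⟩
  rcases lt_trichotomy l (m + 1) with hlm | rfl | hlm
  · rw [hne l hlm.ne]
    rcases h with ⟨-, -, hin⟩ | ⟨⟨-, -, hin⟩, -⟩ <;> exact hin l hsl (by omega)
  · omega
  · rw [hne l hlm.ne']
    rcases h with ⟨-, -, hin⟩ | ⟨-, -, -, hin⟩
    · exact hin l hsl hl
    · exact hle.trans_lt (hin l hlm hl)

theorem IsExcursion.dig_valley (hne : ∀ n, n ≠ m + 1 → g n = f n) (hdown : f m = f (m + 1) + 1)
    (hsm : s < m) (hme : m + 2 < e) (h : IsExcursion g s e) :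
    IsExcursion f s e ∨ (IsExcursion f s (m + 1) ∧ IsExcursion f (m + 1) e) := by
  simp only [IsExcursion, hne s (by omega), hne e (by omega)] at h ⊢
  obtain ⟨hlt, heq, hin⟩ := h
  have hin' : ∀ l, s < l → l < e → l ≠ m + 1 → f s < f l := fun l hsl hle hl =>
    hne l hl ▸ hin l hsl hle
  have hm := hin' m hsm (by omega) (by omega)
  rcases (show f s ≤ f (m + 1) by omega).lt_or_eq with hlow | hlow
  · refine Or.inl ⟨hlt, heq, fun l hsl hle => ?_⟩
    rcases eq_or_ne l (m + 1) with rfl | hl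
    exacts [hlow, hin' l hsl hle hl]
  · refine Or.inr ⟨⟨by omega, hlow.symm, fun l hsl hl => hin' l hsl (by omega) (by omega)⟩,
      by omega, by omega, fun l hl hle => ?_⟩
    rw [← hlow]
    exact hin' l (by omega) hle (by omega)

theorem isExcursion_iff_of_valley (hne : ∀ n, n ≠ m + 1 → g n = f n)
    (hdown : f m = f (m + 1) + 1) (hpeak : g (m + 1) = f m + 1)
    (hsm : s ≠ m) (hsm1 : s ≠ m + 1) (hem1 : e ≠ m + 1) (hem2 : e ≠ m + 2) :
    IsExcursion g s e ↔
      IsExcursion f s e ∨ (IsExcursion f s (m + 1) ∧ IsExcursion f (m + 1) e) := by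
  by_cases hin : s < m ∧ m + 2 < e
  · exact ⟨IsExcursion.dig_valley hne hdown hin.1 hin.2,
      IsExcursion.fill_valley hne hdown hpeak hin.1 hin.2⟩
  · rw [isExcursion_congr fun n hsn hne' => hne n (by omega), iff_self_or]
    rintro ⟨h, h'⟩
    have := h.1
    have := h'.1
    omega

/-- The path `g` follows `f` up to time `m + 1`, is lower than `f` by 2 as long as `f` stays above
height 1 from time `m + 2` on, and follows `f` again afterwards. -/
structure IsLowering (f g : ℕ → ℕ) (m : ℕ) : Prop where
  path : IsPath f
  zero : f m = 0
  one : f (m + 1) = 1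
  two : f (m + 2) = 2
  before : ∀ n ≤ m + 1, g n = f n
  low : ∀ n, m + 2 ≤ n → (∀ l, m + 2 ≤ l → l ≤ n → 1 < f l) → g n + 2 = f n
  after : ∀ n, m + 2 ≤ n → (∃ l, m + 2 ≤ l ∧ l ≤ n ∧ f l ≤ 1) → g n = f n

theorem IsLowering.isExcursion_of_le_one (h : IsLowering f g m)
    (hs : m + 2 ≤ s) (hlow : ∀ l, m + 2 ≤ l → l ≤ s → 1 < f l) (hnext : f (s + 1) ≤ 1)
    (hg : IsExcursion g s e) : IsExcursion f (m + 1) (s + 1) ∧ IsExcursion f m e := by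
  obtain ⟨hlt, heq, hin⟩ := hg
  have hstep := h.path s
  have hsv := h.low s hs hlow
  have hafter : ∀ l, s < l → g l = f l := fun l hl =>
    h.after l (by omega) ⟨s + 1, by omega, hl, hnext⟩
  have hone := h.one
  have hzero := h.zero
  refine ⟨⟨by omega, by omega, fun l hl hls => ?_⟩, by omega, ?_, fun l hl hle => ?_⟩
  · have := hlow l (by omega) (by omega)
    omega
  · have := hafter e hlt
    omega
  · rw [h.zero]
    rcases lt_or_ge s l with hsl | hsl
    · have := hin l hsl hle
      have := hafter l hsl
      omega
    · rcases (show m + 1 ≤ l by omega).eq_or_lt with rfl | hl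
      · omega
      · have := hlow l hl hsl
        omega

theorem IsLowering.isExcursion_of_one_lt (h : IsLowering f g m)
    (hs : m + 2 ≤ s) (hlow : ∀ l, m + 2 ≤ l → l ≤ s → 1 < f l) (hnext : 1 < f (s + 1))
    (hg : IsExcursion g s e) : IsExcursion f s e := by
  obtain ⟨hlt, heq, hin⟩ := hg
  have hhigh : ∀ n, s ≤ n → n ≤ e → ∀ l, m + 2 ≤ l → l ≤ n → 1 < f l := by
    intro n hsn
    induction n, hsn using Nat.le_induction with
    | base => exact fun _ => hlow
    | succ n hsn ih =>
      intro hne l hl hln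
      have ih := ih (by omega)
      rcases hln.lt_or_eq with hln | rfl
      · exact ih l hl (by omega)
      have hsv := h.low s hs hlow
      have hv := h.low n (by omega) ih
      have := h.path n
      rcases hsn.eq_or_lt with rfl | hsn
      · omega
      · have := hin n hsn (by omega)
        omega
  have hval : ∀ n, s ≤ n → n ≤ e → g n + 2 = f n := fun n hsn hne =>
    h.low n (by omega) (hhigh n hsn hne)
  have := hval s le_rfl hlt.le
  have := hval e hlt.le le_rfl
  refine ⟨hlt, by omega, fun l hsl hle => ?_⟩
  have := hval l hsl.le hle.le
  have := hin l hsl hle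
  omega

theorem IsLowering.isExcursion_of_low (h : IsLowering f g m) (hs : m + 2 ≤ s)
    (hlow : ∀ l, m + 2 ≤ l → l ≤ s → 1 < f l) (hf : IsExcursion f s e) : IsExcursion g s e := by
  obtain ⟨hlt, heq, hin⟩ := hf
  have hsf := hlow s hs le_rfl
  have hval : ∀ n, s ≤ n → n ≤ e → g n + 2 = f n := by
    refine fun n hsn hne => h.low n (by omega) fun l hl hln => ?_
    rcases le_or_gt l s with hls | hls
    · exact hlow l hl hls
    · rcases (show l ≤ e by omega).eq_or_lt with rfl | hle
      · omega
      · exact hsf.trans (hin l hls hle)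
  have := hval s le_rfl hlt.le
  have := hval e hlt.le le_rfl
  refine ⟨hlt, by omega, fun l hsl hle => ?_⟩
  have := hval l hsl.le hle.le
  have := hin l hsl hle
  omega

theorem IsLowering.isExcursion_of_reconnect (h : IsLowering f g m)
    (hs : IsExcursion f (m + 1) (s + 1)) (he : IsExcursion f m e) : IsExcursion g s e := by
  have hone := h.one
  have htwo := h.two
  have hzero := h.zero
  obtain ⟨hms, hfs, hlow⟩ := hs
  obtain ⟨hme, hfe, hpos⟩ := he
  have hs : m + 2 ≤ s := by
    by_contra hc
    obtain rfl : s = m + 1 := by omega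
    exact absurd (htwo.symm.trans hfs) (by omega)
  have hgs := h.low s hs fun l hl hls => by
    have := hlow l (by omega) (by omega)
    omega
  have hfs2 : f s = 2 := by
    have := h.path s
    have := hlow s (by omega) (by omega)
    omega
  have hse : s + 1 < e := by
    by_contra hc
    rcases lt_trichotomy e (m + 1) with he | rfl | he
    · omega
    · omega
    · rcases (not_lt.1 hc).eq_or_lt with rfl | hc
      · omega
      · have := hlow e he hc
        omega
  have hafter : ∀ l, s < l → g l = f l := fun l hl =>
    h.after l (by omega) ⟨s + 1, by omega, hl, by omega⟩
  refine ⟨by omega, by rw [hafter e (by omega)]; omega, fun l hsl hle => ?_⟩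
  have := hpos l (by omega) hle
  rw [hafter l hsl]
  omega

theorem IsLowering.isExcursion_iff (h : IsLowering f g m) (hsm : s ≠ m) (hsm1 : s ≠ m + 1)
    (hem1 : e ≠ m + 1) (hem2 : e ≠ m + 2) :
    IsExcursion g s e ↔
      IsExcursion f s e ∨ (IsExcursion f (m + 1) (s + 1) ∧ IsExcursion f m e) := by
  have hzero := h.zero
  have htwo := h.two
  have hmove : ∀ {s e}, IsExcursion f (m + 1) (s + 1) ∧ IsExcursion f m e → IsExcursion g s e :=
    fun hf => h.isExcursion_of_reconnect hf.1 hf.2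
  rcases lt_or_gt_of_ne hsm with hs | hs
  · have hnot : ¬ (IsExcursion f (m + 1) (s + 1) ∧ IsExcursion f m e) := fun hf => by
      have := hf.1.1
      omega
    rw [or_iff_left hnot]
    rcases le_or_gt e m with he | he
    · exact isExcursion_congr fun n _ hne => h.before n (by omega)
    · have hgm := h.low (m + 2) le_rfl fun l hl hl' => by
        obtain rfl : l = m + 2 := by omega
        omega
      refine iff_of_false (fun hg => ?_) fun hf => ?_
      · have := hg.2.2 (m + 2) (by omega) (by omega)
        omega
      · have := hf.2.2 m hs he
        omega
  by_cases hlow : ∀ l, m + 2 ≤ l → l ≤ s → 1 < f l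
  · refine ⟨fun hg => ?_, fun hf => hf.elim (h.isExcursion_of_low (by omega) hlow) hmove⟩
    rcases le_or_gt (f (s + 1)) 1 with hnext | hnext
    · exact Or.inr (h.isExcursion_of_le_one (by omega) hlow hnext hg)
    · exact Or.inl (h.isExcursion_of_one_lt (by omega) hlow hnext hg)
  push Not at hlow
  obtain ⟨l, hl, hls, hfl⟩ := hlow
  have hiff : IsExcursion g s e ↔ IsExcursion f s e :=
    isExcursion_congr fun n hsn _ => h.after n (by omega) ⟨l, hl, by omega, hfl⟩
  exact ⟨fun hg => Or.inl (hiff.1 hg), fun hf => hf.elim hiff.2 hmove⟩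

end Move

/-! ### The matching of a diagram -/

/-- The vertices `i` and `j` are the ends of an arc. -/
def Joined (a : Finset ℕ+) (i j : ℕ+) : Prop := IsArc a i j ∨ IsArc a j i

section Joined
variable {a b : Finset ℕ+} {i j x y : ℕ+} {m n : ℕ}

theorem isMatching_joined (a : Finset ℕ+) : IsMatching (Joined a) where
  symm := Or.symm
  unique := by
    rintro i j j' (h | h) (h' | h')
    exacts [h.right_unique h', (h'.not_isArc h).elim, (h.not_isArc h').elim, h.left_unique h']
  irrefl _ h := h.elim (fun h => h.lt.false) fun h => h.lt.false

theorem height_congr (h : height a m = height b m)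
    (hab : ∀ k : ℕ+, m < k → (k : ℕ) ≤ n → (k ∈ a ↔ k ∈ b)) (hmn : m ≤ n) :
    height a n = height b n := by
  induction n, hmn using Nat.le_induction with
  | base => exact h
  | succ n hmn ih =>
    have ih := ih fun k hmk hkn => hab k hmk (by omega)
    simp only [height, ih, hab n.succPNat (Nat.lt_succ_of_le hmn) le_rfl]

theorem height_congr_of_le (hab : ∀ k : ℕ+, (k : ℕ) ≤ n → (k ∈ a ↔ k ∈ b)) :
    height a n = height b n :=
  height_congr rfl (fun k _ => hab k) n.zero_le

theorem height_of_notMem_of_eq (hx : (x : ℕ) = m + 1) (hxa : x ∉ a) :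
    height a (m + 1) = height a m + 1 := by
  simpa only [hx, Nat.add_sub_cancel] using height_of_notMem hxa

theorem height_of_mem_of_eq (hx : (x : ℕ) = m + 1) (hxa : x ∈ a) :
    height a m = 0 ∧ height a (m + 1) = 1 ∨ height a m = height a (m + 1) + 1 := by
  simpa only [hx, Nat.add_sub_cancel] using height_of_mem hxa

section Adjacent
variable (hx : (x : ℕ) = m + 1) (hy : (y : ℕ) = m + 2)
  (hab : ∀ k, k ≠ x → k ≠ y → (k ∈ a ↔ k ∈ b))
include hx hy hab

theorem height_eq_of_le (hn : n ≤ m) : height a n = height b n :=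
  height_congr_of_le fun k hk =>
    hab k (fun h => by subst h; omega) fun h => by subst h; omega

theorem height_eq_of_ge (hmn : m + 2 ≤ n) {l : ℕ} (hnl : n ≤ l) (h : height a n = height b n) :
    height a l = height b l :=
  height_congr h (fun k hk _ => hab k (fun h => by subst h; omega) fun h => by subst h; omega) hnl

theorem height_add_two_eq_or_height_eq (hbase : height a (m + 2) + 2 = height b (m + 2))
    (htwo : 1 < height b (m + 2)) (hmn : m + 2 ≤ n) :
    (∀ l, m + 2 ≤ l → l ≤ n → 1 < height b l) ∧ height a n + 2 = height b n ∨
      (∃ l, m + 2 ≤ l ∧ l ≤ n ∧ height b l ≤ 1) ∧ height a n = height b n := by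
  induction n, hmn using Nat.le_induction with
  | base => exact Or.inl ⟨fun l hml hlm => le_antisymm hml hlm ▸ htwo, hbase⟩
  | succ n hmn ih =>
    rcases ih with ⟨hlow, ih⟩ | ⟨⟨l, hml, hln, hl⟩, ih⟩
    · have hn : (n.succPNat : ℕ) = n + 1 := rfl
      have hbit := hab n.succPNat (fun h => by subst h; omega) fun h => by subst h; omega
      have := hlow n hmn le_rfl
      have hstep : height a (n + 1) + 2 = height b (n + 1) ∨
          height b (n + 1) ≤ 1 ∧ height a (n + 1) = height b (n + 1) := by
        by_cases hb : n.succPNat ∈ b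
        · have := height_of_mem_of_eq hn hb
          have := height_of_mem_of_eq hn (hbit.2 hb)
          omega
        · have := height_of_notMem_of_eq hn hb
          have := height_of_notMem_of_eq hn (hbit.not.2 hb)
          omega
      by_cases hnext : height b (n + 1) ≤ 1
      · exact Or.inr ⟨⟨n + 1, by omega, le_rfl, hnext⟩, by omega⟩
      · refine Or.inl ⟨fun l hml hln => ?_, by omega⟩
        rcases hln.lt_or_eq with hln | rfl
        exacts [hlow l hml (by omega), not_le.1 hnext]
    · exact Or.inr ⟨⟨l, hml, by omega, hl⟩, height_eq_of_ge hx hy hab hmn n.le_succ ih⟩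

theorem isLowering_height (hya : y ∈ a) (hyb : y ∉ b) (hzero : height b m = 0) :
    IsLowering (height b) (height a) m := by
  have hle : ∀ n ≤ m, height a n = height b n := fun n hn => height_eq_of_le hx hy hab hn
  have hm := hle m le_rfl
  have hone : ∀ c : Finset ℕ+, height c m = 0 → height c (m + 1) = 1 := fun c hc => by
    have := isPath_height c m
    omega
  have hbm := hone b hzero
  have ham := hone a (hm.trans hzero)
  have htwo : height b (m + 2) = 2 := by
    have : height b (m + 2) = height b (m + 1) + 1 := height_of_notMem_of_eq hy hyb
    omega
  have ha0 : height a (m + 2) = 0 := by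
    have : height a (m + 1) = 0 ∧ _ ∨ height a (m + 1) = height a (m + 2) + 1 :=
      height_of_mem_of_eq hy hya
    omega
  have hafter := fun n => height_add_two_eq_or_height_eq (n := n) hx hy hab (by omega) (by omega)
  refine ⟨isPath_height b, hzero, hbm, htwo, fun n hn => ?_, fun n hmn hlow => ?_,
    fun n hmn ⟨l, hml, hln, hl⟩ => ?_⟩
  · rcases hn.lt_or_eq with hn | rfl
    · exact hle n (by omega)
    · omega
  · rcases hafter n hmn with ⟨-, heq⟩ | ⟨⟨l, hml, hln, hl⟩, -⟩
    exacts [heq, absurd (hlow l hml hln) hl.not_gt]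
  · rcases hafter n hmn with ⟨hlow, -⟩ | ⟨-, heq⟩
    exacts [absurd (hlow l hml hln) hl.not_gt, heq]

theorem height_eq_of_ne (hxa : x ∉ a) (hya : y ∈ a) (hxb : x ∈ b) (hyb : y ∉ b)
    (hpos : height b m ≠ 0) (hn : n ≠ m + 1) : height a n = height b n := by
  rcases hn.lt_or_gt with hn | hn
  · exact height_eq_of_le hx hy hab (by omega)
  · refine height_eq_of_ge hx hy hab le_rfl hn ?_
    have := height_eq_of_le (n := m) hx hy hab le_rfl
    have := height_of_notMem_of_eq hx hxa
    have := height_of_mem_of_eq hx hxb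
    have : height a (m + 1) = 0 ∧ _ ∨ height a (m + 1) = height a (m + 2) + 1 :=
      height_of_mem_of_eq hy hya
    have : height b (m + 2) = height b (m + 1) + 1 := height_of_notMem_of_eq hy hyb
    omega

theorem isArc_iff_reconnect (hxa : x ∈ a ↔ x ∉ b) (hya : y ∈ a) (hyb : y ∉ b)
    (hxb : x ∈ b ∨ height b m = 0) (hix : i ≠ x) (hiy : i ≠ y) (hjx : j ≠ x) (hjy : j ≠ y) :
    IsArc a i j ↔ IsArc b i j ∨ (IsArc b i x ∧ IsArc b y j) ∨ (IsArc b y i ∧ IsArc b x j) := by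
  have hi := i.pos
  have hix : (i : ℕ) ≠ x := PNat.coe_injective.ne hix
  have hiy : (i : ℕ) ≠ y := PNat.coe_injective.ne hiy
  have hjx : (j : ℕ) ≠ x := PNat.coe_injective.ne hjx
  have hjy : (j : ℕ) ≠ y := PNat.coe_injective.ne hjy
  have hm1 : (x : ℕ) - 1 = m := by omega
  have hm2 : (y : ℕ) - 1 = m + 1 := by omega
  by_cases hzero : height b m = 0
  · have hnot : ¬ IsArc b i x := fun h => by
      have := h.height_right
      rw [hm1] at this
      omega
    have hiff : IsArc a i j ↔ IsArc b i j ∨ (IsArc b y i ∧ IsArc b x j) := by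
      simpa only [IsArc, hm1, hm2, Nat.sub_add_cancel hi] using
        (isLowering_height hx hy hab hya hyb hzero).isExcursion_iff (s := i - 1) (e := j)
          (by omega) (by omega) (by omega) (by omega)
    simp only [hiff, hnot, false_and, false_or]
  · have hxb := hxb.resolve_right hzero
    have hdown := height_of_mem_of_eq hx hxb
    have hnot : ¬ IsArc b x j := fun h => by
      have := h.height_left
      rw [hm1, hx] at this
      omega
    have hne := fun n => height_eq_of_ne (n := n) hx hy hab (hxa.not_left.2 hxb) hya hxb hyb hzero
    have hpeak := height_of_notMem_of_eq hx (hxa.not_left.2 hxb)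
    rw [hne m (by omega)] at hpeak
    have hiff : IsArc a i j ↔ IsArc b i j ∨ (IsArc b i x ∧ IsArc b y j) := by
      simpa only [IsArc, hx, hm2] using
        isExcursion_iff_of_valley (s := i - 1) (e := j) hne (by omega) hpeak (by omega) (by omega)
          (by omega) (by omega)
    simp only [hiff, hnot, and_false, or_false]

end Adjacent

theorem not_joined_of_notMem (hxy : x < y) (hyb : y ∉ b) : ¬ Joined b x y :=
  fun h => h.elim (fun h => hyb h.right_mem) fun h => h.lt.not_gt hxy

theorem isArc_of_adjacent (hx : (x : ℕ) = m + 1) (hy : (y : ℕ) = m + 2) (hya : y ∈ a)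
    (hxa : x ∈ a → height a m = 0) : IsArc a x y := by
  have hup : height a (m + 1) = height a m + 1 := by
    have := isPath_height a m
    by_cases h : x ∈ a
    · have := hxa h
      omega
    · exact height_of_notMem_of_eq hx h
  have hdown : height a (m + 1) = 0 ∧ _ ∨ height a (m + 1) = height a (m + 2) + 1 :=
    height_of_mem_of_eq hy hya
  rw [IsArc, hx, hy, Nat.add_sub_cancel]
  refine ⟨by omega, by omega, fun l hml hlm => ?_⟩
  obtain rfl : l = m + 1 := by omega
  omega

theorem joined_symmDiff_pair (hx : (x : ℕ) = m + 1) (hy : (y : ℕ) = m + 2) (hyb : y ∉ b)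
    (hxb : x ∈ b ∨ height b m = 0) :
    Joined (symmDiff b {x, y}) = Reconnect (Joined b) x y := by
  obtain ⟨a, ha⟩ : ∃ a, a = symmDiff b {x, y} := ⟨_, rfl⟩
  have hmem : ∀ k, k ∈ a ↔ ¬ (k ∈ b ↔ k = x ∨ k = y) := fun k => by
    simp only [ha, Finset.mem_symmDiff, Finset.mem_insert, Finset.mem_singleton]
    tauto
  have hab : ∀ k, k ≠ x → k ≠ y → (k ∈ a ↔ k ∈ b) := fun k hkx hky => by simp [hmem, hkx, hky]
  have hxa : x ∈ a ↔ x ∉ b := by simp [hmem]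
  have hya : y ∈ a := by simp [hmem, hyb]
  have hxy : IsArc a x y := isArc_of_adjacent hx hy hya fun h =>
    (height_eq_of_le hx hy hab le_rfl).trans (hxb.resolve_left (hxa.1 h))
  rw [← ha]
  refine (isMatching_joined a).eq_reconnect (Or.inl hxy) fun i j hix hiy hjx hjy => ?_
  have h := isArc_iff_reconnect hx hy hab hxa hya hyb hxb hix hiy hjx hjy
  have h' := isArc_iff_reconnect hx hy hab hxa hya hyb hxb hjx hjy hix hiy
  have hnot : ∀ k, ¬ IsArc b k y := fun k hk => hyb hk.right_mem
  simp only [Joined, h, h', hnot, or_false, false_or]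
  grind only

end Joined

/-! ### Depth in the hypercube of a diagram -/

section Depth
variable {a b : Finset ℕ+} {d : ℕ}

theorem pairwiseDisjoint_arcs (a : Finset ℕ+) :
    (arcs a).PairwiseDisjoint fun p => ({p.1, p.2} : Finset ℕ+) := by
  rintro ⟨i, j⟩ hp ⟨i', j'⟩ hq hne
  rw [mem_arcs] at hp hq
  rw [Function.onFun, Finset.disjoint_left]
  intro k hk hk'
  simp only [Finset.mem_insert, Finset.mem_singleton] at hk hk'
  rcases hk with rfl | rfl <;> rcases hk' with rfl | rfl
  · exact hne (by rw [hp.right_unique hq])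
  · exact hq.not_isArc hp
  · exact hp.not_isArc hq
  · exact hne (by rw [hp.left_unique hq])

theorem AtDepth.saturated (h : AtDepth a b d) : Saturated (Joined a) (symmDiff a b) := by
  obtain ⟨S, hS, -, rfl⟩ := h
  rw [symmDiff_symmDiff_cancel_left]
  intro i hi
  simp only [Finset.mem_biUnion, Finset.mem_insert, Finset.mem_singleton] at hi ⊢
  obtain ⟨p, hp, hi⟩ := hi
  have harc : IsArc a p.1 p.2 := mem_arcs.1 (hS hp)
  rcases hi with rfl | rfl
  · exact ⟨p.2, ⟨p, hp, Or.inr rfl⟩, Or.inl harc⟩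
  · exact ⟨p.1, ⟨p, hp, Or.inl rfl⟩, Or.inr harc⟩

theorem AtDepth.card_symmDiff (h : AtDepth a b d) : (symmDiff a b).card = d * 2 := by
  obtain ⟨S, hS, rfl, rfl⟩ := h
  rw [symmDiff_symmDiff_cancel_left, Finset.card_biUnion ((pairwiseDisjoint_arcs a).subset hS)]
  exact Finset.sum_const_nat fun p hp => Finset.card_pair (mem_arcs.1 (hS hp)).lt.ne

theorem Saturated.exists_atDepth (h : Saturated (Joined a) (symmDiff a b)) :
    ∃ d, AtDepth a b d := by
  classical
  obtain ⟨u, hu⟩ : ∃ u, u = symmDiff a b := ⟨_, rfl⟩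
  rw [← hu] at h
  refine ⟨_, (u ×ˢ u).filter (fun p => IsArc a p.1 p.2),
    fun p hp => mem_arcs.2 (Finset.mem_filter.1 hp).2, rfl, ?_⟩
  rw [← symmDiff_symmDiff_cancel_left a b, ← hu]
  congr 1
  ext k
  simp only [Finset.mem_biUnion, Finset.mem_filter, Finset.mem_product, Finset.mem_insert,
    Finset.mem_singleton]
  constructor
  · intro hk
    obtain ⟨j, hj, h | h⟩ := h k hk
    · exact ⟨(k, j), ⟨⟨hk, hj⟩, h⟩, Or.inl rfl⟩
    · exact ⟨(j, k), ⟨⟨hj, hk⟩, h⟩, Or.inr rfl⟩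
  · rintro ⟨p, ⟨⟨h1, h2⟩, -⟩, rfl | rfl⟩
    exacts [h1, h2]

theorem AtDepth.weight_eq (h : AtDepth a b d) :
    weight (Joined a) (symmDiff a b) = LaurentPolynomial.T (d : ℤ) := by
  rw [weight_of_saturated h.saturated, h.card_symmDiff, Nat.mul_div_cancel d two_pos]

theorem weight_eq_zero_of_not_atDepth (h : ¬ ∃ d, AtDepth a b d) :
    weight (Joined a) (symmDiff a b) = 0 :=
  weight_of_not_saturated fun hs => h hs.exists_atDepth

theorem coeff_zero_weight (h : a ≠ b) : (weight (Joined a) (symmDiff a b)).coeff 0 = 0 := by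
  by_cases hd : ∃ d, AtDepth a b d
  · obtain ⟨d, hd⟩ := hd
    have hd0 : d ≠ 0 := by
      rintro rfl
      exact h (symmDiff_eq_bot.1 (Finset.card_eq_zero.1 (by simpa using hd.card_symmDiff)))
    rw [hd.weight_eq, LaurentPolynomial.T]
    simp [hd0]
  · rw [weight_eq_zero_of_not_atDepth hd]
    rfl

end Depth

noncomputable section

open Equiv (Perm swap)

/-! ### Signed permutations -/

section Signed
variable {w w' : Space ≃ₗ[ℝ] Space} {σ σ' : Perm ℕ+} {a a' : Finset ℕ+}

/-- The linear map `w` is an even signed permutation of the coordinates: coordinate `k` of `w x` is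
coordinate `σ k` of `x`, with the opposite sign if `σ k` lies in the finite set `a` of even
order. -/
def Signed (w : Space ≃ₗ[ℝ] Space) (σ : Perm ℕ+) (a : Finset ℕ+) : Prop :=
  Even a.card ∧ ∀ x k, w x k = if σ k ∈ a then -x (σ k) else x (σ k)

theorem even_card_symmDiff {α : Type*} [DecidableEq α] {s t : Finset α} (hs : Even s.card)
    (ht : Even t.card) : Even (symmDiff s t).card := by
  have hs' := Finset.card_sdiff_add_card_inter s t
  have ht' := Finset.card_sdiff_add_card_inter t s
  rw [Finset.inter_comm] at ht'
  have hst : (symmDiff s t).card = (s \ t).card + (t \ s).card := by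
    rw [symmDiff_def, Finset.sup_eq_union, Finset.card_union_of_disjoint disjoint_sdiff_sdiff]
  rw [Nat.even_iff] at *
  omega

theorem Signed.one : Signed 1 1 ∅ := ⟨by simp, fun x k => by simp⟩

theorem Signed.mul (h : Signed w σ a) (h' : Signed w' σ' a') :
    Signed (w * w') (σ' * σ) (symmDiff a' (a.map σ'.toEmbedding)) := by
  refine ⟨even_card_symmDiff h'.1 (by simpa using h.1), fun x k => ?_⟩
  rw [LinearEquiv.mul_apply, h.2, h'.2, Perm.mul_apply]
  by_cases h1 : σ k ∈ a <;> by_cases h2 : σ' (σ k) ∈ a' <;> simp [Finset.mem_symmDiff, h1, h2]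

theorem Signed.inv (h : Signed w σ a) : Signed w⁻¹ σ⁻¹ (a.map (σ⁻¹).toEmbedding) := by
  refine ⟨by simpa using h.1, fun x k => ?_⟩
  obtain ⟨y, rfl⟩ := w.surjective x
  have hy : (w⁻¹ : Space ≃ₗ[ℝ] Space) (w y) = y := w.symm_apply_apply y
  have hk : σ⁻¹ k ∈ a.map (σ⁻¹).toEmbedding ↔ k ∈ a := Finset.mem_map' (σ⁻¹).toEmbedding
  simp only [hy, h.2, hk]
  by_cases hk : k ∈ a <;> simp [hk]

theorem Refl.signed (r : Refl) :
    Signed r.equiv (swap r.i r.j) (if r.neg then {r.i, r.j} else ∅) := by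
  have hne : r.i ≠ r.j := ne_of_lt r.lt
  constructor
  · split_ifs
    · rw [Finset.card_pair hne]
      exact even_two
    · simp
  · intro x k
    change r.map x k = _
    by_cases h1 : k = r.i
    · subst h1
      cases hn : r.neg <;> simp [Refl.map, hn]
    by_cases h2 : k = r.j
    · subst h2
      cases hn : r.neg <;> simp [Refl.map, hn, hne.symm]
    · cases hn : r.neg <;> simp [Refl.map, h1, h2, Equiv.swap_apply_of_ne_of_ne]

theorem exists_signed (hw : w ∈ D) : ∃ σ a, Signed w σ a := by
  induction hw using Subgroup.closure_induction with
  | mem _ h =>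
    obtain ⟨r, rfl⟩ := h
    exact ⟨_, _, r.signed⟩
  | one => exact ⟨_, _, Signed.one⟩
  | mul _ _ _ _ h h' =>
    obtain ⟨_, _, h⟩ := h
    obtain ⟨_, _, h'⟩ := h'
    exact ⟨_, _, h.mul h'⟩
  | inv _ _ h =>
    obtain ⟨_, _, h⟩ := h
    exact ⟨_, _, h.inv⟩

theorem Refl.equiv_mem (r : Refl) : r.equiv ∈ D := Subgroup.subset_closure ⟨r, rfl⟩

theorem continuous_of_mem (hw : w ∈ D) : Continuous w := by
  obtain ⟨σ, a, -, h⟩ := exists_signed hw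
  refine continuous_pi fun k => ?_
  simp only [h]
  split_ifs <;> fun_prop

end Signed

/-! ### Conjugation of reflections -/

/-- The reflection `(i j)` or `(i j)₋` for distinct indices in either order. -/
def Refl.ofNe (i j : ℕ+) (h : i ≠ j) (neg : Bool) : Refl :=
  if hij : i < j then ⟨i, j, hij, neg⟩ else ⟨j, i, h.lt_or_gt.resolve_left hij, neg⟩

theorem Refl.ofNe_equiv_apply {i j : ℕ+} (h : i ≠ j) (neg : Bool) (x : Space) (k : ℕ+) :
    (Refl.ofNe i j h neg).equiv x k =
      if k = i then (if neg then -x j else x j)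
      else if k = j then (if neg then -x i else x i) else x k := by
  change (Refl.ofNe i j h neg).map x k = _
  unfold Refl.ofNe
  split_ifs <;> simp_all [Refl.map]

theorem Refl.ofNe_form_mul_form {i j : ℕ+} (h : i ≠ j) (neg : Bool) (x y : Space) :
    (Refl.ofNe i j h neg).form x * (Refl.ofNe i j h neg).form y =
      if neg then (x i + x j) * (y i + y j) else (x i - x j) * (y i - y j) := by
  unfold Refl.ofNe
  split_ifs <;> simp_all only [Refl.form, Bool.false_eq_true, if_true, if_false] <;> ring

/- Whether two points lie on the same side of a hyperplane depends only on the product of the values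
of the form, and this product, unlike the form, does not depend on the order of the indices. -/
theorem exists_conj {w : Space ≃ₗ[ℝ] Space} (hw : w ∈ D) (t : Refl) :
    ∃ r : Refl, t.equiv * w = w * r.equiv ∧
      ∀ x y, t.form (w x) * t.form (w y) = r.form x * r.form y := by
  obtain ⟨σ, a, h⟩ := exists_signed hw
  have hne : t.i ≠ t.j := t.lt.ne
  refine ⟨Refl.ofNe (σ t.i) (σ t.j) (σ.injective.ne hne)
    (xor t.neg (xor (decide (σ t.i ∈ a)) (decide (σ t.j ∈ a)))), ?_, fun x y => ?_⟩
  · refine LinearEquiv.ext fun x => funext fun k => ?_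
    rw [LinearEquiv.mul_apply, LinearEquiv.mul_apply, h.2, Refl.ofNe_equiv_apply]
    change t.map (w x) k = _
    simp only [Refl.map, LinearMap.coe_mk, AddHom.coe_mk, h.2, EmbeddingLike.apply_eq_iff_eq]
    by_cases hki : k = t.i
    · subst hki
      cases t.neg <;> by_cases hi : σ t.i ∈ a <;> by_cases hj : σ t.j ∈ a <;> simp [hi, hj]
    by_cases hkj : k = t.j
    · subst hkj
      cases t.neg <;> by_cases hi : σ t.i ∈ a <;> by_cases hj : σ t.j ∈ a <;>
        simp [hi, hj, hne.symm]
    · simp [hki, hkj]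
  · rw [Refl.ofNe_form_mul_form]
    simp only [Refl.form, h.2]
    cases t.neg <;> by_cases hi : σ t.i ∈ a <;> by_cases hj : σ t.j ∈ a <;> simp [hi, hj] <;> ring

theorem Refl.equiv_apply_vMinus_ne_iff (r : Refl) (k : ℕ+) :
    r.equiv vMinus k ≠ vMinus k ↔ k = r.i ∨ k = r.j := by
  have hi : (0 : ℝ) < (r.i : ℕ) := by exact_mod_cast r.i.pos
  have hlt : ((r.i : ℕ) : ℝ) < (r.j : ℕ) := by exact_mod_cast r.lt
  have hne : r.j ≠ r.i := r.lt.ne'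
  change r.map vMinus k ≠ _ ↔ _
  simp only [Refl.map, LinearMap.coe_mk, AddHom.coe_mk, vMinus]
  by_cases hki : k = r.i
  · subst hki
    simp only [if_true, true_or, iff_true]
    split_ifs <;> intro h <;> linarith
  by_cases hkj : k = r.j
  · subst hkj
    simp only [if_true, hne, if_false, or_true, iff_true]
    split_ifs <;> intro h <;> linarith
  · simp [hki, hkj]

theorem Refl.equiv_injective : Function.Injective Refl.equiv := by
  intro r t h
  have hsupp : ∀ k, (k = r.i ∨ k = r.j) ↔ (k = t.i ∨ k = t.j) := fun k => by
    rw [← r.equiv_apply_vMinus_ne_iff, ← t.equiv_apply_vMinus_ne_iff, h]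
  obtain ⟨i, j, hij, n⟩ := r
  obtain ⟨i', j', hij', n'⟩ := t
  simp only at hsupp
  obtain ⟨rfl, rfl⟩ : i = i' ∧ j = j' := by
    have hi := hsupp i
    have hj := hsupp j
    grind
  have hv : Refl.map ⟨i, j, hij, n⟩ vMinus i = Refl.map ⟨i, j, hij', n'⟩ vMinus i :=
    congrFun (congrArg (fun w : Space ≃ₗ[ℝ] Space => w vMinus) h) i
  simp only [Refl.map, LinearMap.coe_mk, AddHom.coe_mk, if_true, vMinus] at hv
  cases n <;> cases n' <;> simp at hv ⊢

/-! ### Alcoves -/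

section Cells
variable {w w' : Space ≃ₗ[ℝ] Space} {x y : Space} {r : Refl}

theorem apply_mem_cell (hw : w ∈ D) (h : x ∈ cell Set.univ y) : w x ∈ cell Set.univ (w y) := by
  intro t _
  obtain ⟨r, -, hr⟩ := exists_conj hw t
  rw [hr]
  exact h r trivial

theorem image_fundAlcove (hw : w ∈ D) : w '' fundAlcove = cell Set.univ (w vMinus) := by
  ext x
  constructor
  · rintro ⟨y, hy, rfl⟩
    exact apply_mem_cell hw hy
  · intro h
    obtain ⟨y, rfl⟩ := w.surjective x
    refine ⟨y, ?_, rfl⟩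
    rw [fundAlcove]
    simpa only [LinearEquiv.coe_inv, LinearEquiv.symm_apply_apply] using
      apply_mem_cell (D.inv_mem hw) h

theorem form_vMinus_of_pos (h : r.neg = false) : 0 < r.form vMinus := by
  have hlt : ((r.i : ℕ) : ℝ) < (r.j : ℕ) := by exact_mod_cast r.lt
  simp [Refl.form, h, vMinus, hlt]

theorem form_vMinus_of_neg (h : r.neg = true) : r.form vMinus < 0 := by
  have hi : (0 : ℝ) < (r.i : ℕ) := by exact_mod_cast r.i.pos
  have hj : (0 : ℝ) < (r.j : ℕ) := by exact_mod_cast r.j.pos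
  simp only [Refl.form, h, vMinus, if_true]
  linarith

theorem vMinus_mem_fundAlcove : vMinus ∈ fundAlcove := by
  intro r _
  cases h : r.neg
  · exact mul_pos (form_vMinus_of_pos h) (form_vMinus_of_pos h)
  · exact mul_pos_of_neg_of_neg (form_vMinus_of_neg h) (form_vMinus_of_neg h)

theorem mem_fundChamber : x ∈ fundChamber ↔ StrictAnti x := by
  constructor
  · intro h i j hij
    have hform := pos_of_mul_pos_right (h ⟨i, j, hij, false⟩ rfl) (form_vMinus_of_pos rfl).le
    simpa [Refl.form] using hform
  · intro h r (hr : r.neg = false)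
    refine mul_pos (form_vMinus_of_pos hr) ?_
    simpa [Refl.form, hr] using h r.lt

theorem mem_fundAlcove : x ∈ fundAlcove ↔ StrictAnti x ∧ x 1 + x 2 < 0 := by
  constructor
  · intro h
    refine ⟨mem_fundChamber.1 fun r _ => h r trivial, ?_⟩
    have hform :=
      neg_of_mul_pos_right (h ⟨1, 2, by decide, true⟩ trivial) (form_vMinus_of_neg rfl).le
    simpa [Refl.form] using hform
  · rintro ⟨h, h12⟩ r _
    cases hr : r.neg
    · refine mul_pos (form_vMinus_of_pos hr) ?_
      simpa [Refl.form, hr] using h r.lt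
    · refine mul_pos_of_neg_of_neg (form_vMinus_of_neg hr) ?_
      have hi : x r.i ≤ x 1 := h.antitone one_le
      have hj : x r.j ≤ x 2 := h.antitone (Order.add_one_le_of_lt (one_le.trans_lt r.lt))
      simp only [Refl.form, hr, if_true]
      linarith

theorem image_subset_fundChamber (hw : w ∈ D) :
    w '' fundAlcove ⊆ fundChamber ↔ StrictAnti (w vMinus) := by
  rw [← mem_fundChamber]
  constructor
  · exact fun h => h ⟨_, vMinus_mem_fundAlcove, rfl⟩
  · intro h y hy r hr
    rw [image_fundAlcove hw] at hy
    have hv := form_vMinus_of_pos hr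
    have hwv : 0 < r.form (w vMinus) := pos_of_mul_pos_right (h r hr) hv.le
    exact mul_pos hv (pos_of_mul_pos_right (hy r trivial) hwv.le)

theorem separates_iff (hw : w ∈ D) (r : Refl) :
    (∀ x ∈ w '' fundAlcove, ∀ y ∈ fundAlcove, r.form x * r.form y < 0) ↔
      r.form (w vMinus) * r.form vMinus < 0 := by
  constructor
  · exact fun h => h _ ⟨_, vMinus_mem_fundAlcove, rfl⟩ _ vMinus_mem_fundAlcove
  · intro h x hx y hy
    rw [image_fundAlcove hw] at hx
    have hx : 0 < r.form (w vMinus) * r.form x := hx r trivial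
    have hy : 0 < r.form vMinus * r.form y := hy r trivial
    have hxy : (r.form (w vMinus) * r.form vMinus) * (r.form x * r.form y) > 0 :=
      (mul_pos hx hy).trans_eq (by ring)
    exact neg_of_mul_pos_right hxy h.le

end Cells

/-! ### The orbit of `v₋` -/

section Orbit
variable {w w' : Space ≃ₗ[ℝ] Space} {σ σ' : Perm ℕ+} {a a' : Finset ℕ+}

/-- The entry of absolute value `n` of the points of the orbit of `v₋` with the set `a` of positive
entries. -/
def entry (a : Finset ℕ+) (n : ℕ+) : ℤ := if n ∈ a then (n : ℕ) else -((n : ℕ) : ℤ)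

theorem entry_injective (a : Finset ℕ+) : Function.Injective (entry a) := by
  intro m n h
  have := m.pos
  have := n.pos
  apply PNat.coe_injective
  unfold entry at h
  split_ifs at h <;> omega

theorem entry_pos_iff {n : ℕ+} : 0 < entry a n ↔ n ∈ a := by
  have := n.pos
  unfold entry
  split_ifs with h <;> simp only [h, iff_true, iff_false] <;> omega

theorem entry_add_entry_pos_iff {m n : ℕ+} (h : n < m) :
    0 < entry a m + entry a n ↔ m ∈ a := by
  have := n.pos
  have hlt : (n : ℕ) < m := h
  unfold entry
  split_ifs with hm hn <;> simp only [hm, iff_true, iff_false] <;> omega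

theorem Signed.apply_vMinus (h : Signed w σ a) (k : ℕ+) : w vMinus k = (entry a (σ k) : ℝ) := by
  rw [h.2, entry, vMinus]
  split_ifs <;> simp

theorem Signed.mem_iff (h : Signed w σ a) (n : ℕ+) :
    n ∈ a ↔ ∃ k, w vMinus k = ((n : ℕ) : ℝ) := by
  simp only [h.apply_vMinus]
  constructor
  · intro hn
    exact ⟨σ⁻¹ n, by simp [entry, hn]⟩
  · rintro ⟨k, hk⟩
    have hk : entry a (σ k) = ((n : ℕ) : ℤ) := by exact_mod_cast hk
    have hmem : σ k ∈ a := entry_pos_iff.1 (hk ▸ by exact_mod_cast n.pos)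
    rw [entry, if_pos hmem] at hk
    rwa [← PNat.coe_injective (Int.ofNat.inj hk)]

theorem Signed.signs_unique (h : Signed w σ a) (h' : Signed w σ' a') : a = a' := by
  ext n
  rw [h.mem_iff, h'.mem_iff]

theorem Signed.ext_of_strictAnti (h : Signed w σ a) (h' : Signed w' σ' a)
    (hw : StrictAnti (w vMinus)) (hw' : StrictAnti (w' vMinus)) : w = w' := by
  have hrange : ∀ {w : Space ≃ₗ[ℝ] Space} {σ : Perm ℕ+}, Signed w σ a →
      Set.range (w vMinus) = Set.range fun n => (entry a n : ℝ) := by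
    intro w σ h
    rw [show w vMinus = (fun n => (entry a n : ℝ)) ∘ σ from funext h.apply_vMinus,
      σ.surjective.range_comp]
  have hv : w vMinus = w' vMinus := (StrictMono.range_inj (γ := ℝᵒᵈ) hw.dual_right
    hw'.dual_right).1 ((hrange h).trans (hrange h').symm)
  obtain rfl : σ = σ' := by
    ext1 k
    apply entry_injective a
    exact_mod_cast (h.apply_vMinus k).symm.trans ((congrFun hv k).trans (h'.apply_vMinus k))
  exact LinearEquiv.ext fun x => funext fun k => by rw [h.2, h'.2]

theorem eq_one_of_apply_vMinus_mem (hw : w ∈ D) (h : w vMinus ∈ fundAlcove) : w = 1 := by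
  obtain ⟨σ, a, hs⟩ := exists_signed hw
  obtain ⟨hanti, h12⟩ := mem_fundAlcove.1 h
  have hsub : a ⊆ {σ 1} := by
    intro n hn
    obtain ⟨k, rfl⟩ := σ.surjective n
    rw [Finset.mem_singleton, EmbeddingLike.apply_eq_iff_eq]
    by_contra hk
    have hk2 : w vMinus k ≤ w vMinus 2 :=
      hanti.antitone (Order.add_one_le_of_lt (lt_of_le_of_ne one_le (Ne.symm hk)))
    have h21 : w vMinus 2 < w vMinus 1 := hanti (by decide)
    have hpos : (0 : ℝ) < w vMinus k := by
      rw [hs.apply_vMinus]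
      exact_mod_cast entry_pos_iff.2 hn
    linarith
  have ha : a = ∅ := by
    have hcard := Finset.card_le_card hsub
    have heven := hs.1
    rw [Finset.card_singleton] at hcard
    rw [Nat.even_iff] at heven
    exact Finset.card_eq_zero.1 (by omega)
  subst ha
  exact hs.ext_of_strictAnti Signed.one hanti (mem_fundAlcove.1 vMinus_mem_fundAlcove).1

theorem eq_of_apply_vMinus_mem (hw : w ∈ D) (hw' : w' ∈ D) (h : w' vMinus ∈ w '' fundAlcove) :
    w' = w := by
  obtain ⟨y, hy, hyw⟩ := h
  have hmem : (w⁻¹ * w') vMinus ∈ fundAlcove := by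
    rwa [LinearEquiv.mul_apply, ← hyw, LinearEquiv.coe_inv, LinearEquiv.symm_apply_apply]
  exact (inv_mul_eq_one.1 (eq_one_of_apply_vMinus_mem (D.mul_mem (D.inv_mem hw) hw') hmem)).symm

theorem eq_of_image_eq (hw : w ∈ D) (hw' : w' ∈ D) (h : w '' fundAlcove = w' '' fundAlcove) :
    w = w' :=
  eq_of_apply_vMinus_mem hw' hw (h ▸ ⟨_, vMinus_mem_fundAlcove, rfl⟩)

end Orbit

/-! ### Dominant alcoves -/

section Dominant
variable {A : DomAlcove} {w : Space ≃ₗ[ℝ] Space} {σ : Perm ℕ+} {a : Finset ℕ+}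

theorem DomAlcove.exists_rep (A : DomAlcove) :
    ∃ w ∈ D, A.1 = w '' fundAlcove ∧ StrictAnti (w vMinus) := by
  obtain ⟨A, ⟨w, hw, rfl⟩, hA⟩ := A
  exact ⟨w, hw, rfl, (image_subset_fundChamber hw).1 hA⟩

/-- The element of `𝒟` that takes the fundamental alcove to `A`. -/
def rep (A : DomAlcove) : Space ≃ₗ[ℝ] Space := A.exists_rep.choose

theorem rep_mem (A : DomAlcove) : rep A ∈ D := A.exists_rep.choose_spec.1

theorem image_rep (A : DomAlcove) : A.1 = rep A '' fundAlcove := A.exists_rep.choose_spec.2.1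

theorem strictAnti_rep (A : DomAlcove) : StrictAnti (rep A vMinus) :=
  A.exists_rep.choose_spec.2.2

theorem rep_eq (hw : w ∈ D) (h : A.1 = w '' fundAlcove) : rep A = w :=
  eq_of_image_eq (rep_mem A) hw (by rw [← h, image_rep])

theorem rep_injective : Function.Injective rep := by
  intro A B h
  apply Subtype.ext
  rw [image_rep A, image_rep B, h]

/-- The alcove of an element of `𝒟` that takes `v₋` to a descending sequence. -/
def ofRep (w : Space ≃ₗ[ℝ] Space) (hw : w ∈ D) (h : StrictAnti (w vMinus)) : DomAlcove :=
  ⟨w '' fundAlcove, ⟨w, hw, rfl⟩, (image_subset_fundChamber hw).2 h⟩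

theorem rep_ofRep (hw : w ∈ D) (h : StrictAnti (w vMinus)) : rep (ofRep w hw h) = w :=
  rep_eq hw rfl

/-- The permutation of the coordinates that underlies `rep A`. -/
def perm (A : DomAlcove) : Perm ℕ+ := (exists_signed (rep_mem A)).choose

/-- The label of `A` as a finite set. -/
def lab (A : DomAlcove) : Finset ℕ+ := (exists_signed (rep_mem A)).choose_spec.choose

theorem signed_rep (A : DomAlcove) : Signed (rep A) (perm A) (lab A) :=
  (exists_signed (rep_mem A)).choose_spec.choose_spec

theorem lab_eq (h : Signed (rep A) σ a) : lab A = a := (signed_rep A).signs_unique h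

theorem label_eq_lab (A : DomAlcove) : label A = (lab A : Set ℕ+) := by
  ext n
  rw [Finset.mem_coe, (signed_rep A).mem_iff]
  constructor
  · rintro ⟨w, hw, hA, hk⟩
    rw [image_rep A] at hA
    rwa [← eq_of_apply_vMinus_mem (rep_mem A) hw hA]
  · intro hk
    refine ⟨rep A, rep_mem A, ?_, hk⟩
    rw [image_rep A]
    exact ⟨_, vMinus_mem_fundAlcove, rfl⟩

theorem even_card_lab (A : DomAlcove) : Even (lab A).card := (signed_rep A).1

theorem lab_injective : Function.Injective lab := fun A B h =>
  rep_injective ((h ▸ signed_rep A).ext_of_strictAnti (signed_rep B) (strictAnti_rep A)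
    (strictAnti_rep B))

/-! ### Lengths -/

theorem form_rep_mul_form_vMinus_neg_iff (A : DomAlcove) (r : Refl) :
    r.form (rep A vMinus) * r.form vMinus < 0 ↔
      r.neg = true ∧ max (perm A r.i) (perm A r.j) ∈ lab A := by
  cases hr : r.neg
  · have hv := form_vMinus_of_pos hr
    have hA : 0 < r.form (rep A vMinus) := by
      simpa [Refl.form, hr] using strictAnti_rep A r.lt
    simpa using (mul_pos hA hv).le
  · have hv := form_vMinus_of_neg hr
    have hA : r.form (rep A vMinus) =
        ((entry (lab A) (perm A r.i) + entry (lab A) (perm A r.j) : ℤ) : ℝ) := by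
      simp [Refl.form, hr, (signed_rep A).apply_vMinus]
    have hsign : r.form (rep A vMinus) * r.form vMinus < 0 ↔ 0 < r.form (rep A vMinus) :=
      ⟨fun h => pos_of_mul_neg_left h hv.le, fun h => mul_neg_of_pos_of_neg h hv⟩
    rw [hsign, hA, Int.cast_pos]
    rcases lt_or_gt_of_ne ((perm A).injective.ne r.lt.ne) with hlt | hlt
    · rw [max_eq_right hlt.le, add_comm, entry_add_entry_pos_iff hlt]
      simp
    · rw [max_eq_left hlt.le, entry_add_entry_pos_iff hlt]
      simp

/- A reflection `(i j)₋` is determined by the larger and the smaller one of `σ i` and `σ j`. -/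
theorem ncard_neg_refl_max_mem (σ : Perm ℕ+) (a : Finset ℕ+) :
    Set.ncard {r : Refl | r.neg = true ∧ max (σ r.i) (σ r.j) ∈ a} =
      ∑ m ∈ a, ((m : ℕ) - 1) := by
  have hcard : (a.sigma fun m => Finset.Ico 1 m).card = ∑ m ∈ a, ((m : ℕ) - 1) := by
    rw [Finset.card_sigma]
    exact Finset.sum_congr rfl fun m _ => PNat.card_Ico _ _
  rw [← hcard, ← Set.ncard_coe_finset]
  refine Set.ncard_congr (fun r _ => ⟨max (σ r.i) (σ r.j), min (σ r.i) (σ r.j)⟩) ?_ ?_ ?_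
  · rintro r ⟨-, hr⟩
    simpa using ⟨hr, r.lt.ne'⟩
  · rintro ⟨i, j, hij, n⟩ ⟨i', j', hij', n'⟩ ⟨hn, -⟩ ⟨hn', -⟩ h
    simp only at hn hn'
    subst hn hn'
    simp only [Sigma.mk.injEq, heq_eq_eq] at h
    have hσ : (σ i = σ i' ∧ σ j = σ j') ∨ (σ i = σ j' ∧ σ j = σ i') := by grind
    simp only [EmbeddingLike.apply_eq_iff_eq] at hσ
    rcases hσ with ⟨rfl, rfl⟩ | ⟨rfl, rfl⟩
    · rfl
    · exact (lt_asymm hij hij').elim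
  · rintro ⟨m, n⟩ hmn
    simp only [Finset.coe_sigma, Set.mem_sigma_iff, Finset.mem_coe, Finset.mem_Ico, one_le,
      true_and] at hmn
    obtain ⟨hm, hlt⟩ := hmn
    rcases lt_or_gt_of_ne (σ⁻¹.injective.ne hlt.ne) with hij | hij
    · refine ⟨⟨σ⁻¹ n, σ⁻¹ m, hij, true⟩, ⟨rfl, ?_⟩, ?_⟩ <;> simp [hlt.le, hm]
    · refine ⟨⟨σ⁻¹ m, σ⁻¹ n, hij, true⟩, ⟨rfl, ?_⟩, ?_⟩ <;> simp [hlt.le, hm]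

theorem length_eq (A : DomAlcove) : length A.1 = ∑ m ∈ lab A, ((m : ℕ) - 1) := by
  rw [length, image_rep A, ← ncard_neg_refl_max_mem (perm A)]
  simp only [separates_iff (rep_mem A), form_rep_mul_form_vMinus_neg_iff]

end Dominant

/-! ### Walls -/

section Walls
variable {w : Space ≃ₗ[ℝ] Space} {x y : Space} {r t : Refl} {R : Set Refl} {A : Set Space}

theorem Refl.form_add_smul (r : Refl) (x y : Space) (c : ℝ) :
    r.form (x + c • y) = r.form x + c * r.form y := by
  simp only [Refl.form, Pi.add_apply, Pi.smul_apply, smul_eq_mul]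
  split_ifs <;> ring

theorem Refl.continuous_form (r : Refl) : Continuous r.form := by
  unfold Refl.form
  split_ifs <;> fun_prop

theorem mem_closure_cell (hx : ∀ r ∈ R, r.form x ≠ 0) :
    y ∈ closure (cell R x) ↔ ∀ r ∈ R, 0 ≤ r.form x * r.form y := by
  constructor
  · intro h r hr
    exact closure_minimal (fun z hz => (hz r hr).le)
      (isClosed_le continuous_const (continuous_const.mul r.continuous_form)) h
  · intro h
    have hc : Continuous fun δ : ℝ => y + δ • x := by fun_prop
    have ht : Filter.Tendsto (fun δ : ℝ => y + δ • x) (nhdsWithin 0 (Set.Ioi 0)) (nhds y) := by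
      simpa using (hc.tendsto 0).mono_left (nhdsWithin_le_nhds (s := Set.Ioi 0))
    refine mem_closure_of_tendsto ht ?_
    filter_upwards [self_mem_nhdsWithin] with δ (hδ : 0 < δ) r hr
    have hsq : 0 < r.form x * r.form x := mul_self_pos.2 (hx r hr)
    calc 0 < r.form x * r.form y + δ * (r.form x * r.form x) :=
          add_pos_of_nonneg_of_pos (h r hr) (mul_pos hδ hsq)
      _ = r.form x * r.form (y + δ • x) := by rw [r.form_add_smul]; ring

theorem form_vMinus_ne_zero (r : Refl) : r.form vMinus ≠ 0 := by
  cases h : r.neg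
  · exact (form_vMinus_of_pos h).ne'
  · exact (form_vMinus_of_neg h).ne

theorem mem_closure_fundAlcove :
    x ∈ closure fundAlcove ↔ ∀ r : Refl, 0 ≤ r.form vMinus * r.form x := by
  simp [fundAlcove, mem_closure_cell fun r _ => form_vMinus_ne_zero r]

/-- The reflection is `(1 2)₋` or one of the `(k k+1)`. -/
def Refl.IsSimple (r : Refl) : Prop :=
  (r.j : ℕ) = r.i + 1 ∧ (r.neg = true → r.i = 1)

theorem Refl.form_equiv_self (r : Refl) (x : Space) : r.form (r.equiv x) = -r.form x := by
  have hne : r.j ≠ r.i := r.lt.ne'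
  change r.form (r.map x) = _
  simp only [Refl.form, Refl.map, LinearMap.coe_mk, AddHom.coe_mk, if_true, hne, if_false]
  split_ifs <;> ring

theorem Refl.equiv_vMinus_apply (r : Refl) (k : ℕ+) : r.equiv vMinus k =
    ((if k = r.i then (if r.neg then (r.j : ℕ) else -((r.j : ℕ) : ℤ))
      else if k = r.j then (if r.neg then (r.i : ℕ) else -((r.i : ℕ) : ℤ))
      else -((k : ℕ) : ℤ) : ℤ) : ℝ) := by
  change r.map vMinus k = _
  simp only [Refl.map, LinearMap.coe_mk, AddHom.coe_mk, vMinus]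
  split_ifs <;> simp

/- A simple reflection permutes the positive roots other than its own. -/
theorem Refl.IsSimple.form_vMinus_mul_form_equiv_vMinus_pos (hr : r.IsSimple) (h : t ≠ r) :
    0 < t.form vMinus * t.form (r.equiv vMinus) := by
  obtain ⟨i, j, hij, n⟩ := r
  obtain ⟨k, l, hkl, m⟩ := t
  obtain ⟨hj, hi⟩ := hr
  have hkl' : (k : ℕ) < l := hkl
  have := i.pos
  have := k.pos
  have hne : ¬ ((k : ℕ) = i ∧ (l : ℕ) = j ∧ m = n) := by
    rintro ⟨hk, hl, rfl⟩
    obtain rfl := PNat.coe_injective hk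
    obtain rfl := PNat.coe_injective hl
    exact h rfl
  simp only [← PNat.coe_inj, PNat.one_coe] at hi hj
  cases m
  · refine mul_pos (form_vMinus_of_pos rfl) ?_
    simp only [Refl.form, Bool.false_eq_true, if_false, Refl.equiv_vMinus_apply, sub_pos,
      Int.cast_lt, ← PNat.coe_inj]
    cases n <;>
      simp only [Bool.false_eq_true, if_false, if_true, and_true, true_imp_iff] at hi hne ⊢ <;>
      split_ifs <;> omega
  · refine mul_pos_of_neg_of_neg (form_vMinus_of_neg rfl) ?_
    simp only [Refl.form, if_true, Refl.equiv_vMinus_apply, ← Int.cast_add, Int.cast_lt_zero,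
      ← PNat.coe_inj]
    cases n <;>
      simp only [Bool.false_eq_true, if_false, if_true, and_true, true_imp_iff] at hi hne ⊢ <;>
      split_ifs <;> omega

theorem isSimple_of_isWall (h : IsWall t fundAlcove) : t.IsSimple := by
  obtain ⟨x, hx, ht, hne⟩ := h
  rw [mem_closure_fundAlcove] at hx
  obtain ⟨i, j, hij, n⟩ := t
  have hpos : ∀ {k l : ℕ+}, k ≤ l → x l ≤ x k := fun {k l} hkl => by
    rcases hkl.eq_or_lt with rfl | hkl
    · rfl
    · simpa [Refl.form] using
        nonneg_of_mul_nonneg_right (hx ⟨k, l, hkl, false⟩) (form_vMinus_of_pos rfl)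
  cases n
  · have hxij : x i - x j = 0 := by simpa [Refl.form] using ht
    have hij1 : i + 1 ≤ j := Order.add_one_le_of_lt hij
    have hi : x (i + 1) ≤ x i := hpos (PNat.lt_add_right i 1).le
    have hj : x j ≤ x (i + 1) := hpos hij1
    by_contra hs
    refine hne ⟨i, i + 1, PNat.lt_add_right i 1, false⟩ ?_ ?_
    · rintro ⟨⟩
      exact hs ⟨rfl, by simp⟩
    · simp only [Refl.form, Bool.false_eq_true, if_false]
      linarith
  · have hxij : x i + x j = 0 := by simpa [Refl.form] using ht
    have h12 : x 1 + x 2 ≤ 0 := by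
      have hform := hx ⟨1, 2, by decide, true⟩
      simpa [Refl.form] using nonpos_of_mul_nonneg_right hform (form_vMinus_of_neg rfl)
    have hi : x i ≤ x 1 := hpos one_le
    have hj : x j ≤ x 2 := hpos (Order.add_one_le_of_lt (one_le.trans_lt hij))
    by_contra hs
    refine hne ⟨1, 2, by decide, true⟩ ?_ ?_
    · rintro ⟨⟩
      exact hs ⟨rfl, fun _ => rfl⟩
    · simp only [Refl.form, if_true]
      linarith

/- The midpoint of `v₋` and its mirror image lies on the mirror only. -/
theorem Refl.IsSimple.isWall (hr : r.IsSimple) : IsWall r fundAlcove := by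
  have hform : ∀ t : Refl, t.form (vMinus + (1 : ℝ) • r.equiv vMinus) =
      t.form vMinus + t.form (r.equiv vMinus) := fun t => by rw [t.form_add_smul, one_mul]
  have hzero : r.form (vMinus + (1 : ℝ) • r.equiv vMinus) = 0 := by
    rw [hform, r.form_equiv_self, add_neg_cancel]
  have hpos : ∀ t : Refl, t ≠ r →
      0 < t.form vMinus * t.form (vMinus + (1 : ℝ) • r.equiv vMinus) := fun t ht => by
    rw [hform, mul_add]
    exact add_pos (mul_self_pos.2 (form_vMinus_ne_zero t))
      (hr.form_vMinus_mul_form_equiv_vMinus_pos ht)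
  refine ⟨_, mem_closure_fundAlcove.2 fun t => ?_, hzero,
    fun t ht h0 => (hpos t ht).ne' (by rw [h0, mul_zero])⟩
  by_cases ht : t = r
  · rw [ht, hzero, mul_zero]
  · exact (hpos t ht).le

theorem isWall_fundAlcove_iff : IsWall t fundAlcove ↔ t.IsSimple :=
  ⟨isSimple_of_isWall, Refl.IsSimple.isWall⟩

theorem closure_image (hw : w ∈ D) (A : Set Space) : closure (w '' A) = w '' closure A :=
  ((Homeomorph.mk w.toEquiv (continuous_of_mem hw)
    (continuous_of_mem (D.inv_mem hw))).image_closure A).symm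

theorem form_apply_eq_zero_iff (hw : w ∈ D) (h : t.equiv * w = w * r.equiv) :
    t.form (w x) = 0 ↔ r.form x = 0 := by
  obtain ⟨r', hr', hform⟩ := exists_conj hw t
  obtain rfl : r = r' := Refl.equiv_injective (mul_left_cancel (h.symm.trans hr'))
  rw [← mul_self_eq_zero, hform, mul_self_eq_zero]

theorem exists_conj_inv (hw : w ∈ D) (r : Refl) : ∃ t : Refl, t.equiv * w = w * r.equiv := by
  obtain ⟨t, ht, -⟩ := exists_conj (D.inv_mem hw) r
  exact ⟨t, by rw [← eq_mul_inv_iff_mul_eq, mul_assoc, ht, mul_inv_cancel_left]⟩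

theorem isWall_image_iff (hw : w ∈ D) (h : t.equiv * w = w * r.equiv) :
    IsWall t (w '' A) ↔ IsWall r A := by
  unfold IsWall
  simp only [closure_image hw, Set.exists_mem_image, form_apply_eq_zero_iff hw h]
  refine exists_congr fun y => and_congr_right fun _ => and_congr_right fun _ => ?_
  constructor
  · intro hne r' hr'
    obtain ⟨t', ht'⟩ := exists_conj_inv hw r'
    rw [Ne, ← form_apply_eq_zero_iff hw ht']
    refine hne t' ?_
    rintro rfl
    exact hr' (Refl.equiv_injective (mul_left_cancel (ht'.symm.trans h)))
  · intro hne t' ht'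
    obtain ⟨r', hr', -⟩ := exists_conj hw t'
    rw [Ne, form_apply_eq_zero_iff hw hr']
    refine hne r' ?_
    rintro rfl
    exact ht' (Refl.equiv_injective (mul_right_cancel (hr'.trans h.symm)))

end Walls

/-! ### Edges in terms of labels -/

section Labels
variable {r : Refl} {a : Finset ℕ+}

/-- Right multiplication by `r` enlarges the label `a`: `(i j)₋` adds both `r.i` and `r.j`, and
`(i j)` replaces `r.i` by `r.j`. For simple `r`, the edges that correspond to `r` start at these
labels `a`. -/
def Refl.Raises (r : Refl) (a : Finset ℕ+) : Prop := r.j ∉ a ∧ (r.i ∈ a ↔ r.neg = false)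

/-- The opposite of `Refl.Raises`: for simple `r`, the edges that correspond to `r` end at these
labels `a`. -/
def Refl.Lowers (r : Refl) (a : Finset ℕ+) : Prop := r.j ∈ a ∧ (r.i ∈ a ↔ r.neg = true)

theorem Refl.lowers_symmDiff : r.Lowers (symmDiff a {r.i, r.j}) ↔ r.Raises a := by
  cases h : r.neg <;> simp [Refl.Lowers, Refl.Raises, Finset.mem_symmDiff, h]

theorem Refl.raises_symmDiff : r.Raises (symmDiff a {r.i, r.j}) ↔ r.Lowers a := by
  rw [← Refl.lowers_symmDiff, symmDiff_symmDiff_cancel_right]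

theorem Refl.raises_or_lowers_iff :
    r.Raises a ∨ r.Lowers a ↔ ((r.i ∈ a ↔ r.j ∈ a) ↔ r.neg = true) := by
  cases h : r.neg <;> simp only [Refl.Raises, Refl.Lowers, h] <;> grind

theorem symmDiff_pair_of_notMem {α : Type*} [DecidableEq α] {u : Finset α} {x y : α} (hx : x ∉ u)
    (hy : y ∉ u) : symmDiff u {x, y} = insert x (insert y u) := by
  ext z
  simp only [Finset.mem_symmDiff, Finset.mem_insert, Finset.mem_singleton]
  grind

theorem Refl.Raises.not_joined (h : r.Raises a) : ¬ Joined a r.i r.j :=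
  not_joined_of_notMem r.lt h.1

theorem Refl.Raises.joined (hr : r.IsSimple) (h : r.Raises a) :
    Joined (symmDiff a {r.i, r.j}) = Reconnect (Joined a) r.i r.j := by
  have hi : (r.i : ℕ) = r.i.natPred + 1 := r.i.natPred_add_one.symm
  refine joined_symmDiff_pair hi (hr.1.trans (congrArg (· + 1) hi)) h.1 ?_
  cases hn : r.neg
  · exact Or.inl (h.2.2 hn)
  · right
    rw [hr.2 hn]
    rfl

theorem Refl.Raises.sum_symmDiff (hr : r.IsSimple) (h : r.Raises a) :
    ∑ m ∈ symmDiff a {r.i, r.j}, ((m : ℕ) - 1) = ∑ m ∈ a, ((m : ℕ) - 1) + 1 := by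
  obtain ⟨hj, hi⟩ := h
  have hne : r.i ≠ r.j := r.lt.ne
  cases hn : r.neg
  · have hi : r.i ∈ a := hi.2 hn
    have hmove : symmDiff a {r.i, r.j} = insert r.j (a.erase r.i) := by
      ext n
      simp only [Finset.mem_symmDiff, Finset.mem_insert, Finset.mem_singleton, Finset.mem_erase]
      grind
    rw [hmove, Finset.sum_insert (by simp [hj]), ← Finset.add_sum_erase a _ hi, hr.1]
    have := r.i.pos
    omega
  · have hi : r.i ∉ a := by simp [hi, hn]
    rw [symmDiff_pair_of_notMem hi hj, Finset.sum_insert (by simp [hne, hi]),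
      Finset.sum_insert hj, hr.1, hr.2 hn]
    simp [add_comm]

theorem Refl.exists_lowers (he : Even a.card) (h : a ≠ ∅) :
    ∃ r : Refl, r.IsSimple ∧ r.Lowers a := by
  have hcard : 1 < a.card := by
    have := Finset.card_pos.2 (Finset.nonempty_iff_ne_empty.2 h)
    rw [Nat.even_iff] at he
    omega
  have hne : (a.erase 1).Nonempty := by
    obtain ⟨m, hm, hm1⟩ := Finset.exists_mem_ne hcard 1
    exact ⟨m, Finset.mem_erase.2 ⟨hm1, hm⟩⟩
  obtain ⟨m, hm, hmin⟩ := Finset.exists_min_image _ id hne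
  obtain ⟨hm1, hma⟩ := Finset.mem_erase.1 hm
  obtain ⟨n, rfl⟩ := PNat.exists_eq_succ_of_ne_one hm1
  have hlt : n < n + 1 := PNat.lt_add_right n 1
  refine ⟨⟨n, n + 1, hlt, decide (n ∈ a)⟩, ⟨rfl, fun hn => ?_⟩, hma, by simp⟩
  by_contra hn1
  exact hlt.not_ge (hmin n (Finset.mem_erase.2 ⟨hn1, by simpa using hn⟩))

end Labels

section Edges
variable {w : Space ≃ₗ[ℝ] Space} {σ : Perm ℕ+} {a : Finset ℕ+} {r : Refl} {A B : DomAlcove}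

theorem image_mul (w w' : Space ≃ₗ[ℝ] Space) (A : Set Space) : (w * w') '' A = w '' (w' '' A) :=
  Set.image_comp w w' A

theorem eq_mul_equiv_comm {w' : Space ≃ₗ[ℝ] Space} : w' = w * r.equiv ↔ w = w' * r.equiv := by
  have hr : r.equiv * r.equiv = 1 := LinearEquiv.ext r.map_involutive
  constructor <;> rintro rfl <;> rw [mul_assoc, hr, mul_one]

theorem Signed.mul_equiv (h : Signed w σ a) (hr : r.Raises a ∨ r.Lowers a) :
    Signed (w * r.equiv) (swap r.i r.j * σ) (symmDiff a {r.i, r.j}) := by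
  convert h.mul r.signed using 1
  rw [Refl.raises_or_lowers_iff] at hr
  ext n
  cases hn : r.neg <;>
    simp only [Finset.mem_symmDiff, Finset.mem_map_equiv, Equiv.symm_swap, Equiv.swap_apply_def,
      hn, Bool.false_eq_true, if_true, if_false, Finset.mem_insert, Finset.mem_singleton,
      Finset.notMem_empty] at hr ⊢ <;>
    grind

theorem Signed.mul_equiv_of_not (h : Signed w σ a) (hr : ¬ (r.Raises a ∨ r.Lowers a)) :
    Signed (w * r.equiv) (swap r.i r.j * σ) a := by
  convert h.mul r.signed using 1
  rw [Refl.raises_or_lowers_iff] at hr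
  ext n
  cases hn : r.neg <;>
    simp only [Finset.mem_symmDiff, Finset.mem_map_equiv, Equiv.symm_swap, Equiv.swap_apply_def,
      hn, Bool.false_eq_true, if_true, if_false, Finset.mem_insert, Finset.mem_singleton,
      Finset.notMem_empty] at hr ⊢ <;>
    grind

theorem edge_iff : Edge A B ↔
    (∃ r : Refl, r.IsSimple ∧ rep B = rep A * r.equiv) ∧ length B.1 = length A.1 + 1 := by
  refine and_congr_left fun _ => ?_
  have hA := rep_mem A
  constructor
  · rintro ⟨t, ht, hB⟩
    obtain ⟨r, hr, -⟩ := exists_conj hA t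
    rw [image_rep A, isWall_image_iff hA hr, isWall_fundAlcove_iff] at ht
    refine ⟨r, ht, rep_eq (D.mul_mem hA r.equiv_mem) ?_⟩
    rw [hB, image_rep A, ← image_mul, hr]
  · rintro ⟨r, hr, hB⟩
    obtain ⟨t, ht⟩ := exists_conj_inv hA r
    refine ⟨t, ?_, ?_⟩
    · rwa [image_rep A, isWall_image_iff hA ht, isWall_fundAlcove_iff]
    · rw [image_rep A, image_rep B, ← image_mul, ht, hB]

theorem sameOrbit_iff {A' B' : DomAlcove} (h : rep B = rep A * w) :
    SameOrbit A B A' B' ↔ rep B' = rep A' * w := by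
  constructor
  · rintro ⟨g, hg, hA, hB⟩
    have hA' : rep A' = g * rep A := rep_eq (D.mul_mem hg (rep_mem A)) (by
      rw [hA, image_rep A, image_mul])
    have hB' : rep B' = g * rep B := rep_eq (D.mul_mem hg (rep_mem B)) (by
      rw [hB, image_rep B, image_mul])
    rw [hA', hB', h, mul_assoc]
  · intro h'
    refine ⟨rep A' * (rep A)⁻¹, D.mul_mem (rep_mem A') (D.inv_mem (rep_mem A)), ?_, ?_⟩
    · rw [image_rep A, image_rep A', ← image_mul, inv_mul_cancel_right]
    · rw [image_rep B, image_rep B', ← image_mul, h, h', mul_assoc, inv_mul_cancel_left]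

theorem raises_or_lowers_of_rep_eq (h : rep B = rep A * r.equiv) :
    r.Raises (lab A) ∨ r.Lowers (lab A) := by
  by_contra hr
  have hB : Signed (rep B) _ (lab A) := h ▸ (signed_rep A).mul_equiv_of_not hr
  have hone : r.equiv = 1 := by
    rwa [lab_injective (lab_eq hB), eq_comm, mul_eq_left] at h
  exact (r.equiv_apply_vMinus_ne_iff r.i).2 (Or.inl rfl) (by rw [hone]; rfl)

theorem lab_of_rep_eq (h : rep B = rep A * r.equiv) :
    lab B = symmDiff (lab A) {r.i, r.j} :=
  lab_eq (h ▸ (signed_rep A).mul_equiv (raises_or_lowers_of_rep_eq h))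

theorem strictAnti_mul_equiv (hw : w ∈ D) (hr : r.IsSimple) (hwv : StrictAnti (w vMinus))
    (h : ∀ t : Refl, t.neg = false → t.equiv * w ≠ w * r.equiv) :
    StrictAnti ((w * r.equiv) vMinus) := by
  rw [← mem_fundChamber] at hwv ⊢
  intro t ht
  obtain ⟨r', hr', hform⟩ := exists_conj hw t
  have hne : r' ≠ r := by
    rintro rfl
    exact h t ht hr'
  have hv : 0 < t.form vMinus := form_vMinus_of_pos ht
  have hwv : 0 < t.form (w vMinus) := pos_of_mul_pos_right (hwv t ht) hv.le
  refine mul_pos hv (pos_of_mul_pos_right ?_ hwv.le)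
  rw [LinearEquiv.mul_apply, hform]
  exact hr.form_vMinus_mul_form_equiv_vMinus_pos hne

/- Multiplication by `r` changes the set of positive entries, so it does not amount to a reflection
`(i j)` on the left; hence it leads across no hyperplane of `𝒟₊`. -/
theorem exists_neighbour (hr : r.IsSimple) (h : r.Raises (lab A) ∨ r.Lowers (lab A)) :
    ∃ B, rep B = rep A * r.equiv := by
  have hs := (signed_rep A).mul_equiv h
  refine ⟨ofRep _ (D.mul_mem (rep_mem A) r.equiv_mem)
    (strictAnti_mul_equiv (rep_mem A) hr (strictAnti_rep A) fun t ht heq => ?_), rep_ofRep _ _⟩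
  have ht' := t.signed.mul (signed_rep A)
  rw [heq, ht] at ht'
  have hpair : ({r.i, r.j} : Finset ℕ+) = ∅ := by
    simpa using hs.signs_unique ht'
  exact Finset.insert_ne_empty _ _ hpair

theorem length_of_raises (hr : r.IsSimple) (h : rep B = rep A * r.equiv) (ha : r.Raises (lab A)) :
    length B.1 = length A.1 + 1 := by
  rw [length_eq, length_eq, lab_of_rep_eq h, ha.sum_symmDiff hr]

theorem edge_iff_raises (hr : r.IsSimple) (h : rep B = rep A * r.equiv) :
    Edge A B ↔ r.Raises (lab A) := by
  refine ⟨fun hAB => ?_, fun ha => edge_iff.2 ⟨⟨r, hr, h⟩, length_of_raises hr h ha⟩⟩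
  refine (raises_or_lowers_of_rep_eq h).resolve_right fun ha => ?_
  have hlen := length_of_raises hr (eq_mul_equiv_comm.1 h)
    (by rwa [lab_of_rep_eq h, Refl.raises_symmDiff])
  have := hAB.2
  omega

theorem exists_lab_eq (he : Even a.card) : ∃ A, lab A = a := by
  obtain ⟨d, hd⟩ : ∃ d, d = ∑ m ∈ a, ((m : ℕ) - 1) := ⟨_, rfl⟩
  induction d using Nat.strong_induction_on generalizing a with
  | _ d IH =>
    by_cases h : a = ∅
    · have hv : StrictAnti ((1 : Space ≃ₗ[ℝ] Space) vMinus) :=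
        (mem_fundAlcove.1 vMinus_mem_fundAlcove).1
      refine ⟨ofRep 1 D.one_mem hv, lab_eq (σ := 1) ?_⟩
      rw [rep_ofRep, h]
      exact Signed.one
    · obtain ⟨r, hr, ha⟩ := Refl.exists_lowers he h
      have hraise := Refl.raises_symmDiff.2 ha
      have hsum := hraise.sum_symmDiff hr
      rw [symmDiff_symmDiff_cancel_right] at hsum
      have hpair : Even ({r.i, r.j} : Finset ℕ+).card := by
        rw [Finset.card_pair r.lt.ne]
        exact even_two
      obtain ⟨B, hB⟩ := IH _ (by omega) (even_card_symmDiff he hpair) rfl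
      obtain ⟨A, hA⟩ := exists_neighbour hr (Or.inl (hB ▸ hraise))
      exact ⟨A, by rw [lab_of_rep_eq hA, hB, symmDiff_symmDiff_cancel_right]⟩

theorem exists_edge_iff : (∃ B, Edge B A) ↔ lab A ≠ ∅ := by
  constructor
  · rintro ⟨B, hB⟩ h
    have hlen := hB.2
    rw [length_eq A, h, Finset.sum_empty] at hlen
    omega
  · intro h
    obtain ⟨r, hr, ha⟩ := Refl.exists_lowers (even_card_lab A) h
    obtain ⟨B, hB⟩ := exists_neighbour hr (Or.inr ha)
    refine ⟨B, (edge_iff_raises hr (eq_mul_equiv_comm.1 hB)).2 ?_⟩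
    rwa [lab_of_rep_eq hB, Refl.raises_symmDiff]

end Edges

/-! ### The recursion -/

section Recursion

open LaurentPolynomial

variable {A B E E' X Y : DomAlcove} {a b : Finset ℕ+} {r : Refl} {p : DomAlcove → ℤ[T;T⁻¹]}

theorem edge_and_sameOrbit_iff (hr : r.IsSimple) (h : rep A = rep B * r.equiv) :
    Edge X Y ∧ SameOrbit B A X Y ↔ rep Y = rep X * r.equiv ∧ r.Raises (lab X) := by
  rw [sameOrbit_iff h, and_comm]
  exact and_congr_right fun hY => edge_iff_raises hr hY

theorem preRow_eq (hr : r.IsSimple) (h : rep A = rep B * r.equiv) (E : DomAlcove) :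
    preRow B A p E =
      (∑ᶠ E' ∈ {E' | rep E' = rep E * r.equiv ∧ r.Lowers (lab E)}, (T (-1) * p E + p E')) +
      ∑ᶠ E' ∈ {E' | rep E' = rep E * r.equiv ∧ r.Raises (lab E)}, (T 1 * p E + p E') := by
  have hlow : ∀ E', Edge E' E ∧ SameOrbit B A E' E ↔
      rep E' = rep E * r.equiv ∧ r.Lowers (lab E) := fun E' => by
    rw [edge_and_sameOrbit_iff hr h, eq_mul_equiv_comm]
    refine and_congr_right fun hE' => ?_
    rw [lab_of_rep_eq hE', Refl.raises_symmDiff]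
  simp only [preRow, hlow, edge_and_sameOrbit_iff hr h]

theorem preRow_of_lowers (hr : r.IsSimple) (h : rep A = rep B * r.equiv)
    (hE : rep E' = rep E * r.equiv) (ha : r.Lowers (lab E)) :
    preRow B A p E = T (-1) * p E + p E' := by
  have hna : ¬ r.Raises (lab E) := fun hn => hn.1 ha.1
  simp [preRow_eq hr h, ha, hna, ← hE, rep_injective.eq_iff]

theorem preRow_of_raises (hr : r.IsSimple) (h : rep A = rep B * r.equiv)
    (hE : rep E' = rep E * r.equiv) (ha : r.Raises (lab E)) :
    preRow B A p E = T 1 * p E + p E' := by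
  have hna : ¬ r.Lowers (lab E) := fun hn => ha.1 hn.1
  simp [preRow_eq hr h, ha, hna, ← hE, rep_injective.eq_iff]

theorem preRow_of_not (hr : r.IsSimple) (h : rep A = rep B * r.equiv)
    (ha : ¬ (r.Raises (lab E) ∨ r.Lowers (lab E))) : preRow B A p E = 0 := by
  rw [not_or] at ha
  simp [preRow_eq hr h, ha]

/-- The entry of the hypercube of `a` at `b`: `v ^ d` if `b` is a vertex at depth `d`, and `0` if
`b` is not a vertex. -/
def hypercube (a b : Finset ℕ+) : ℤ[T;T⁻¹] := weight (Joined a) (symmDiff a b)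

theorem hypercube_symmDiff_of_lowers (hr : r.IsSimple) (ha : r.Raises a) (hb : r.Lowers b) :
    hypercube (symmDiff a {r.i, r.j}) b =
      T (-1) * hypercube a b + hypercube a (symmDiff b {r.i, r.j}) := by
  have hx : r.i ∉ symmDiff (symmDiff a b) {r.i, r.j} := by
    simp [Finset.mem_symmDiff, ha.2, hb.2]
  have hy : r.j ∉ symmDiff (symmDiff a b) {r.i, r.j} := by
    simp [Finset.mem_symmDiff, ha.1, hb.1]
  rw [hypercube, hypercube, hypercube, ha.joined hr, symmDiff_right_comm, ← symmDiff_assoc,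
    weight_reconnect (isMatching_joined a) ha.not_joined hx hy r.lt.ne,
    ← symmDiff_pair_of_notMem hx hy, symmDiff_symmDiff_cancel_right]

theorem hypercube_symmDiff_of_raises (hr : r.IsSimple) (ha : r.Raises a) (hb : r.Raises b) :
    hypercube (symmDiff a {r.i, r.j}) b =
      T 1 * hypercube a b + hypercube a (symmDiff b {r.i, r.j}) := by
  have hx : r.i ∉ symmDiff a b := by simp [Finset.mem_symmDiff, ha.2, hb.2]
  have hy : r.j ∉ symmDiff a b := by simp [Finset.mem_symmDiff, ha.1, hb.1]
  rw [hypercube, hypercube, hypercube, ha.joined hr, symmDiff_right_comm, ← symmDiff_assoc,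
    symmDiff_pair_of_notMem hx hy,
    weight_reconnect_insert (isMatching_joined a) ha.not_joined hx hy r.lt.ne]

theorem hypercube_symmDiff_of_not (hr : r.IsSimple) (ha : r.Raises a)
    (hb : ¬ (r.Raises b ∨ r.Lowers b)) : hypercube (symmDiff a {r.i, r.j}) b = 0 := by
  have ha' := Refl.raises_or_lowers_iff.1 (Or.inl ha)
  rw [Refl.raises_or_lowers_iff] at hb
  rw [hypercube, ha.joined hr, symmDiff_right_comm]
  apply weight_of_not_saturated
  by_cases hi : r.i ∈ symmDiff (symmDiff a b) {r.i, r.j}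
  · refine not_saturated_reconnect_left hi ?_
    simp only [Finset.mem_symmDiff, Finset.mem_insert, Finset.mem_singleton] at hi ⊢
    grind
  · refine not_saturated_reconnect_right hi ?_
    simp only [Finset.mem_symmDiff, Finset.mem_insert, Finset.mem_singleton] at hi ⊢
    grind

theorem preRow_hypercube (h : Edge B A) (E : DomAlcove) :
    preRow B A (fun E => hypercube (lab B) (lab E)) E = hypercube (lab A) (lab E) := by
  obtain ⟨⟨r, hr, hA⟩, -⟩ := edge_iff.1 h
  have hB := (edge_iff_raises hr hA).1 h
  rw [lab_of_rep_eq hA]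
  by_cases hE : r.Raises (lab E) ∨ r.Lowers (lab E)
  · obtain ⟨E', hE'⟩ := exists_neighbour hr hE
    rcases hE with hE | hE
    · rw [preRow_of_raises hr hA hE' hE, lab_of_rep_eq hE', hypercube_symmDiff_of_raises hr hB hE]
    · rw [preRow_of_lowers hr hA hE' hE, lab_of_rep_eq hE', hypercube_symmDiff_of_lowers hr hB hE]
  · rw [preRow_of_not hr hA hE, hypercube_symmDiff_of_not hr hB hE]

theorem hypercube_empty (b : Finset ℕ+) : hypercube ∅ b = if b = ∅ then 1 else 0 := by
  rw [hypercube, symmDiff_comm, ← Finset.bot_eq_empty, symmDiff_bot, Finset.bot_eq_empty]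
  split_ifs with hb
  · subst hb
    simpa using weight_of_saturated (M := Joined ∅) (u := ∅) (by simp [Saturated])
  · refine weight_of_not_saturated fun h => ?_
    obtain ⟨k, hk⟩ := Finset.nonempty_iff_ne_empty.2 hb
    obtain ⟨j, -, hj | hj⟩ := h k hk
    · exact Finset.notMem_empty j hj.right_mem
    · exact Finset.notMem_empty k hj.right_mem

theorem pKL_eq_hypercube (c : EdgeChoice) (A E : DomAlcove) :
    pKL c A E = hypercube (lab A) (lab E) := by
  obtain ⟨d, hd⟩ : ∃ d, d = length A.1 := ⟨_, rfl⟩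
  induction d using Nat.strong_induction_on generalizing A E with
  | _ d IH =>
    rw [pKL]
    by_cases h : ∃ B, Edge B A
    · have hB := (c A h).2
      have hrow : pKL c (c A h).1 = fun E => hypercube (lab (c A h).1) (lab E) :=
        funext fun E => IH _ (hd ▸ hB.length_lt) _ E rfl
      have hcoeff : ∀ F : {F : DomAlcove // Lt F A}, (hypercube (lab A) (lab F.1)).coeff 0 = 0 :=
        fun F => coeff_zero_weight (lab_injective.ne (ne_of_apply_ne (fun A => length A.1)
          F.2.length_lt.ne'))
      simp [dif_pos h, hrow, preRow_hypercube hB, hcoeff]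
    · have hA : lab A = ∅ := not_not.1 (mt exists_edge_iff.2 h)
      rw [dif_neg h, hA, hypercube_empty, Pi.single_apply]
      simp only [← hA, lab_injective.eq_iff]

end Recursion

end

end DKL

/-- For every choice `c` of edges in the recursion: the labels identify the dominant alcoves with
the finite subsets of `ℕ+` of even order, and under this identification `p_{a,b} = v ^ d` if `b`
appears in the hypercube `h^a` at depth `d`, and `p_{a,b} = 0` if `b` does not appear in `h^a`. -/
theorem mainTheorem4 (c : DKL.EdgeChoice) :
    (∀ A : DKL.DomAlcove, ∃ a : Finset ℕ+, Even a.card ∧ DKL.label A = (a : Set ℕ+)) ∧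
    (∀ a : Finset ℕ+, Even a.card → ∃! A : DKL.DomAlcove, DKL.label A = (a : Set ℕ+)) ∧
    (∀ (A B : DKL.DomAlcove) (a b : Finset ℕ+),
      DKL.label A = (a : Set ℕ+) → DKL.label B = (b : Set ℕ+) →
        (∀ d : ℕ, DKL.AtDepth a b d →
          DKL.pKL c A B = (LaurentPolynomial.T (d : ℤ) : LaurentPolynomial ℤ)) ∧
        ((¬ ∃ d : ℕ, DKL.AtDepth a b d) → DKL.pKL c A B = 0)) := by
  simp only [DKL.label_eq_lab, Finset.coe_inj]
  refine ⟨fun A => ⟨_, DKL.even_card_lab A, rfl⟩, fun a ha => ?_, ?_⟩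
  · obtain ⟨A, hA⟩ := DKL.exists_lab_eq ha
    exact ⟨A, hA, fun B hB => DKL.lab_injective (hB.trans hA.symm)⟩
  · rintro A B a b rfl rfl
    rw [DKL.pKL_eq_hypercube]
    exact ⟨fun d hd => hd.weight_eq, DKL.weight_eq_zero_of_not_atDepth⟩
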